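/- Fix $t\in\mathbb C\setminus\{0\}$ and put $c=3\,\frac{t-2}{t}$. Let $\mathcal A$ be the (twisted) $N=2$ superconformal algebra with even generators $L_m,H_m$ and odd generators $Q_m,G_m$ ($m\in\mathbb Z$), the central element acting as the number $c$, and with relations (for $m,n\in\mathbb Z$) $$[L_m,L_n]=(m-n)L_{m+n},\quad [H_m,H_n]=\tfrac c3 m\,\delta_{m+n,0},\quad [L_m,G_n]=(m-n)G_{m+n},\quad [H_m,G_n]=G_{m+n},$$ $$[L_m,Q_n]=-nQ_{m+n},\quad [H_m,Q_n]=-Q_{m+n},\quad [L_m,H_n]=-nH_{m+n}+\tfrac c6(m^2+m)\delta_{m+n,0},$$ $$\{G_m,Q_n\}=2L_{m+n}-2nH_{m+n}+\tfrac c3(m^2+m)\delta_{m+n,0},\quad \{G_m,G_n\}=\{Q_m,Q_n\}=0 .$$ For $h,\ell\in\mathbb C$, the massive Verma module $U_{h,\ell,t}$ is the $\mathcal A$-module induced from a vector $|h,\ell,t\rangle$ subject to $Q_n=0$ $(n\ge1)$, $G_n=0$ $(n\ge0)$, $L_n=H_n=0$ $(n\ge1)$, $H_0=h$, $L_0=\ell$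 on it; it is freely generated from $|h,\ell,t\rangle$ by $L_{-m},H_{-m},G_{-m}$ $(m\ge1)$ and $Q_{-m}$ $(m\ge0)$. For $\theta\in\mathbb Z$ and $h'\in\mathbb C$, a vector $x$ of an $\mathcal A$-module satisfies the twisted topological highest-weight conditions with twist $\theta$ and parameter $h'$ if $L_mx=H_mx=0$ $(m\ge1)$, $Q_nx=0$ $(n\ge-\theta)$, $G_nx=0$ $(n\ge\theta)$ and $(H_0+\frac c3\theta)x=h'x$ (and consequently $(L_0+\theta H_0+\frac c6(\theta^2+\theta))x=0$). The twisted topological Verma module $V_{h',t;\theta}$ is the $\mathcal A$-module induced from a vector $|h',t;\theta\rangle_{\rm top}$ subject to these conditions; it is freely generated from it by $L_{-m},H_{-m},Q_{-m-\theta},G_{-m+\theta}$ $(m\ge1)$. For $r\in\mathbb Z$ put $l_{\rm ch}(r,h,t)=r\left(h+\frac{r-1}{t}\right)$. **Theorem.** Let $h,\ell\in\mathbb C$ and $t\in\mathbb C\setminus\{0\}$. 1. The massive Verma module $U_{h,\ell,t}$ contains a twisted topological Verma submodule (a submodule isomorphic to $V_{h',t;\theta}$ for some $h'\in\mathbb C$,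 $\theta\in\mathbb Z$) if and only if $\ell=l_{\rm ch}(r,h,t)$ for some $r\in\mathbb Z$. 2. For every $r\in\mathbb Z$ with $\ell=l_{\rm ch}(r,h,t)$, the vector $$|E\rangle=\begin{cases}Q_r\,Q_{r+1}\cdots Q_0\,|h,\ell,t\rangle, & r\le0,\\ G_{-r}\,G_{-r+1}\cdots G_{-1}\,|h,\ell,t\rangle, & r\ge1,\end{cases}$$ is a corresponding singular vector: it is not a scalar multiple of $|h,\ell,t\rangle$ (in particular it is nonzero), it satisfies the twisted topological highest-weight conditions with $\theta=-r$ and some parameter $h'$, and the submodule it generates is a twisted topological Verma module, with an isomorphism from $V_{h',t;-r}$ that sends $|h',t;-r\rangle_{\rm top}$ to $|E\rangle$. -/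

import Mathlib

noncomputable section

namespace N2

/-- The modes of the twisted `N = 2` superconformal algebra: the Virasoro generators `L n`,
the `U(1)` current `H n`, and the fermionic currents `Q n` and `G n`, with `n` an integer. -/
inductive Gen : Type
  | L (n : ℤ) : Gen
  | H (n : ℤ) : Gen
  | Q (n : ℤ) : Gen
  | G (n : ℤ) : Gen

/-- The central charge `c = 3 (t - 2) / t` (used for `t ≠ 0` only). -/
def centralCharge (t : ℂ) : ℂ := 3 * (t - 2) / t

/-- The Kronecker symbol `δ_{n,0}`. -/
def delta (n : ℤ) : ℂ := if n = 0 then 1 else 0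

/-- The free associative algebra on the modes. -/
abbrev Free : Type := FreeAlgebra ℂ Gen

namespace Free

/-- The generator `L n` of the free algebra. -/
def L (n : ℤ) : Free := FreeAlgebra.ι ℂ (Gen.L n)
/-- The generator `H n` of the free algebra. -/
def H (n : ℤ) : Free := FreeAlgebra.ι ℂ (Gen.H n)
/-- The generator `Q n` of the free algebra. -/
def Q (n : ℤ) : Free := FreeAlgebra.ι ℂ (Gen.Q n)
/-- The generator `G n` of the free algebra. -/
def G (n : ℤ) : Free := FreeAlgebra.ι ℂ (Gen.G n)

end Free

open Free in
/-- The (anti)commutation relations of the twisted `N = 2` superconformal algebra, the central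
element being the number `c`. -/
inductive Rel (c : ℂ) : Free → Free → Prop
  | LL (m n : ℤ) : Rel c (L m * L n - L n * L m) (((m : ℂ) - n) • L (m + n))
  | HH (m n : ℤ) : Rel c (H m * H n - H n * H m) (algebraMap ℂ Free (c / 3 * m * delta (m + n)))
  | LG (m n : ℤ) : Rel c (L m * G n - G n * L m) (((m : ℂ) - n) • G (m + n))
  | HG (m n : ℤ) : Rel c (H m * G n - G n * H m) (G (m + n))
  | LQ (m n : ℤ) : Rel c (L m * Q n - Q n * L m) ((-(n : ℂ)) • Q (m + n))
  | HQ (m n : ℤ) : Rel c (H m * Q n - Q n * H m) (-Q (m + n))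
  | LH (m n : ℤ) : Rel c (L m * H n - H n * L m)
      ((-(n : ℂ)) • H (m + n) + algebraMap ℂ Free (c / 6 * ((m : ℂ) ^ 2 + m) * delta (m + n)))
  | GQ (m n : ℤ) : Rel c (G m * Q n + Q n * G m)
      ((2 : ℂ) • L (m + n) - (2 * (n : ℂ)) • H (m + n)
        + algebraMap ℂ Free (c / 3 * ((m : ℂ) ^ 2 + m) * delta (m + n)))
  | GG (m n : ℤ) : Rel c (G m * G n + G n * G m) 0
  | QQ (m n : ℤ) : Rel c (Q m * Q n + Q n * Q m) 0

/-- The universal enveloping algebra of the twisted `N = 2` superconformal algebra at central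
charge `c`. A module over the superconformal algebra with central charge `c` is the same as a
left module over this associative algebra, with the same submodules. -/
abbrev Alg (c : ℂ) : Type := RingQuot (Rel c)

/-- The mode `L n` of the `N = 2` algebra. -/
def L (c : ℂ) (n : ℤ) : Alg c := RingQuot.mkAlgHom ℂ (Rel c) (Free.L n)
/-- The mode `H n` of the `N = 2` algebra. -/
def H (c : ℂ) (n : ℤ) : Alg c := RingQuot.mkAlgHom ℂ (Rel c) (Free.H n)
/-- The mode `Q n` of the `N = 2` algebra. -/
def Q (c : ℂ) (n : ℤ) : Alg c := RingQuot.mkAlgHom ℂ (Rel c) (Free.Q n)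
/-- The mode `G n` of the `N = 2` algebra. -/
def G (c : ℂ) (n : ℤ) : Alg c := RingQuot.mkAlgHom ℂ (Rel c) (Free.G n)

/-- The elements of the enveloping algebra that kill the highest-weight vector of the massive
Verma module: `Q_{≥1}`, `G_{≥0}`, `L_{≥1}`, `H_{≥1}`, `H_0 - h`, `L_0 - ℓ`. -/
inductive MassiveAnn (h ℓ t : ℂ) : Alg (centralCharge t) → Prop
  | Q (n : ℤ) (hn : 1 ≤ n) : MassiveAnn h ℓ t (Q _ n)
  | G (n : ℤ) (hn : 0 ≤ n) : MassiveAnn h ℓ t (G _ n)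
  | L (n : ℤ) (hn : 1 ≤ n) : MassiveAnn h ℓ t (L _ n)
  | H (n : ℤ) (hn : 1 ≤ n) : MassiveAnn h ℓ t (H _ n)
  | H_zero : MassiveAnn h ℓ t (H _ 0 - algebraMap ℂ _ h)
  | L_zero : MassiveAnn h ℓ t (L _ 0 - algebraMap ℂ _ ℓ)

/-- The left ideal generated by the massive highest-weight conditions. -/
def massiveIdeal (h ℓ t : ℂ) : Submodule (Alg (centralCharge t)) (Alg (centralCharge t)) :=
  Submodule.span _ {a | MassiveAnn h ℓ t a}

/-- The massive Verma module `U_{h,ℓ,t}`, induced from the massive highest-weight conditions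
(so that it is freely generated by `L_{-m}`, `H_{-m}`, `G_{-m}` for `m ≥ 1` and `Q_{-m}` for
`m ≥ 0`, by the Poincaré–Birkhoff–Witt theorem). -/
abbrev MassiveVerma (h ℓ t : ℂ) : Type := Alg (centralCharge t) ⧸ massiveIdeal h ℓ t

/-- The massive highest-weight vector `|h,ℓ,t⟩`. -/
def massiveVec (h ℓ t : ℂ) : MassiveVerma h ℓ t := Submodule.Quotient.mk 1

/-- The elements of the enveloping algebra that kill the highest-weight vector of the twisted
topological Verma module: `L_{≥1}`, `H_{≥1}`, `Q_{≥-θ}`, `G_{≥θ}`, and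
`H_0 + (c/3) θ - h`. -/
inductive TopAnn (h t : ℂ) (θ : ℤ) : Alg (centralCharge t) → Prop
  | L (n : ℤ) (hn : 1 ≤ n) : TopAnn h t θ (L _ n)
  | H (n : ℤ) (hn : 1 ≤ n) : TopAnn h t θ (H _ n)
  | Q (n : ℤ) (hn : -θ ≤ n) : TopAnn h t θ (Q _ n)
  | G (n : ℤ) (hn : θ ≤ n) : TopAnn h t θ (G _ n)
  | H_zero : TopAnn h t θ
      (H _ 0 + algebraMap ℂ _ (centralCharge t / 3 * θ) - algebraMap ℂ _ h)

/-- The left ideal generated by the twisted topological highest-weight conditions. -/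
def topIdeal (h t : ℂ) (θ : ℤ) : Submodule (Alg (centralCharge t)) (Alg (centralCharge t)) :=
  Submodule.span _ {a | TopAnn h t θ a}

/-- The twisted topological Verma module `V_{h,t;θ}`, induced from the twisted topological
highest-weight conditions (so that it is freely generated by `L_{-m}`, `H_{-m}`, `Q_{-m-θ}` and
`G_{-m+θ}` for `m ≥ 1`, by the Poincaré–Birkhoff–Witt theorem). -/
abbrev TopVerma (h t : ℂ) (θ : ℤ) : Type := Alg (centralCharge t) ⧸ topIdeal h t θ

/-- The twisted topological highest-weight vector `|h,t;θ⟩_top`. -/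
def topVec (h t : ℂ) (θ : ℤ) : TopVerma h t θ := Submodule.Quotient.mk 1

/-- The vector `x` satisfies the twisted topological highest-weight conditions with twist `θ` and
parameter `h`. The last condition is a consequence of the others. -/
structure IsTwistedTopHW {M : Type*} [AddCommGroup M] [Module ℂ M] (h t : ℂ) (θ : ℤ)
    [Module (Alg (centralCharge t)) M] (x : M) : Prop where
  L_pos : ∀ m : ℤ, 1 ≤ m → L (centralCharge t) m • x = 0
  H_pos : ∀ m : ℤ, 1 ≤ m → H (centralCharge t) m • x = 0
  Q_ge : ∀ n : ℤ, -θ ≤ n → Q (centralCharge t) n • x = 0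
  G_ge : ∀ n : ℤ, θ ≤ n → G (centralCharge t) n • x = 0
  H_zero : H (centralCharge t) 0 • x + (centralCharge t / 3 * (θ : ℂ)) • x = h • x
  L_zero : L (centralCharge t) 0 • x + (θ : ℂ) • (H (centralCharge t) 0 • x)
    + (centralCharge t / 6 * ((θ : ℂ) ^ 2 + θ)) • x = 0

/-- `l_ch(r,h,t) = r (h + (r - 1) / t)`. -/
def lch (r : ℤ) (h t : ℂ) : ℂ := r * (h + ((r : ℂ) - 1) / t)

/-- The ordered product `Q_a Q_{a+1} ⋯ Q_{a+k-1}` of `k` consecutive modes. -/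
def Qprod (c : ℂ) (a : ℤ) (k : ℕ) : Alg c := ((List.range k).map fun i => Q c (a + i)).prod

/-- The ordered product `G_a G_{a+1} ⋯ G_{a+k-1}` of `k` consecutive modes. -/
def Gprod (c : ℂ) (a : ℤ) (k : ℕ) : Alg c := ((List.range k).map fun i => G c (a + i)).prod

/-- The vector `Q_r ⋯ Q_0 |h,ℓ,t⟩` for `r ≤ 0` and `G_{-r} ⋯ G_{-1} |h,ℓ,t⟩` for `r ≥ 1`. -/
def chargedVec (r : ℤ) (h ℓ t : ℂ) : MassiveVerma h ℓ t :=
  if r ≤ 0 then Qprod (centralCharge t) r (1 - r).toNat • massiveVec h ℓ t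
  else Gprod (centralCharge t) (-r) r.toNat • massiveVec h ℓ t

/-- The module `M` contains a twisted topological Verma submodule, i.e. a submodule isomorphic to
`V_{h',t;θ}` for some `h'` and some integer `θ`. -/
def ContainsTopVerma (t : ℂ) (M : Type*) [AddCommGroup M] [Module (Alg (centralCharge t)) M] :
    Prop :=
  ∃ (N : Submodule (Alg (centralCharge t)) M) (h' : ℂ) (θ : ℤ),
    Nonempty (N ≃ₗ[Alg (centralCharge t)] TopVerma h' t θ)

end N2

end

/-! Call a vector massive of twist `q` if it is killed by `L_{≥1}`, `H_{≥1}`, `Q_{>q}`, `G_{≥-q}`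
and is an eigenvector of `L_0` and `H_0`; `|h,ℓ,t⟩` has twist 0. If `v` is massive of twist `q`,
then `G_{-q-1} v` is massive of twist `q + 1`, and `Q_{q+1}` brings it back to `v` times a number;
`Q_q` lowers the twist in the same way. Along the chain through `|h,ℓ,t⟩` the number between twists
`q` and `q + 1` is `2 (ℓ - l_ch(q+1,h,t))` (`flow_up_down`, `flow_down_up`, `flowFactor_eq`). So `ℓ
= l_ch(r,h,t)` says that one link of the chain is broken: the vector just beyond it has one more
annihilation mode than a massive vector and is therefore twisted topological (`isHW_chargedWord`).

Everything rests on a Poincaré–Birkhoff–Witt theorem for modules induced from a character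
(`isFree_mk`), for any linear order on the modes. It is proved by letting the algebra act on the
span of the standard words. The freedom in the order is used below.

If no link is broken, the massive module is isomorphic to a twisted massive module of every twist
(`nonempty_flow`). A vector killed by all `Q_{≥-θ}` and `G_{≥θ}` is then, for every `k`, in the
image of `Q_{-θ} ⋯ Q_{-θ+k-1}` and of `G_θ ⋯ G_{θ+k-1}`, because these become anticommuting creation
modes after a suitable flow. The bound on the level of a state of given charge rules this out for
large `k` unless the vector is zero (`eq_zero_of_annihilated`). Hence no topological Verma module
embeds.

If a link is broken, the singular vector is a product `U` of odd modes on `|h,ℓ,t⟩`, and its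
descendants must be shown independent. For a suitable degree the algebra is, to leading order,
supercommutative except that `{G_m, Q_{-1-m}}` is `2 L_{-1}`. A topological creation mode that
annihilates `|h,ℓ,t⟩` contracts with its partner in `U` to a multiple of `L_{-1}`. Distinct standard
words thus have distinct leading words (`Embeds.exists_leading`, `Embeds.leading_injective`), which
gives `Embeds.eq_zero`. -/

namespace N2

/-! ### Lie superalgebras acting on standard words -/

open Finsupp

/-- The operator by which a formal combination of generators plus a scalar acts, given the
operators by which the generators act. -/
noncomputable def ev {ι A : Type*} [Ring A] [Algebra ℂ A] (X : ι → A) :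
    (ι →₀ ℂ) × ℂ →ₗ[ℂ] A :=
  (Finsupp.linearCombination ℂ X).coprod (LinearMap.toSpanSingleton ℂ A 1)

lemma ev_apply {ι A : Type*} [Ring A] [Algebra ℂ A] (X : ι → A) (x : (ι →₀ ℂ) × ℂ) :
    ev X x = (x.1.sum fun k a => a • X k) + x.2 • (1 : A) := by
  simp [ev, Finsupp.linearCombination_apply]

lemma ev_end_apply {ι P : Type*} [AddCommGroup P] [Module ℂ P] (X : ι → Module.End ℂ P)
    (x : (ι →₀ ℂ) × ℂ) (y : P) : ev X x y = (x.1.sum fun k a => a • X k y) + x.2 • y := by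
  rw [ev_apply, LinearMap.add_apply, Finsupp.sum, LinearMap.sum_apply]
  rfl

/-- The structure constants of a central extension (with numerical central part) of a Lie
superalgebra with a homogeneous basis whose elements have zero square. -/
structure SuperLie (ι : Type*) where
  odd : ι → Prop
  sgn : ι → ι → ℂ
  br : ι → ι → (ι →₀ ℂ) × ℂ
  sgn_even : ∀ i j, ¬ odd i → sgn i j = 1
  sgn_odd : ∀ i j, odd i → odd j → sgn i j = -1
  sgn_comm : ∀ i j, sgn i j = sgn j i
  skew : ∀ i j, br j i = -(sgn i j • br i j)
  self : ∀ i, br i i = 0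
  sgn_br : ∀ i j k, k ∈ (br i j).1.support → ∀ l, sgn k l = sgn i l * sgn j l
  sgn_sc : ∀ i j, (br i j).2 ≠ 0 → ∀ l, sgn i l = sgn j l
  -- The super Jacobi identity with all double brackets nested on the left. Its second component is
  -- the cocycle condition for the central term.
  jacobi : ∀ i j k, ((br i j).1.sum fun l a => a • br l k) =
    sgn j k • ((br i k).1.sum fun l a => a • br l j)
      - (sgn i j * sgn i k) • (br j k).1.sum fun l a => a • br l i

namespace SuperLie

variable {ι : Type*} (D : SuperLie ι)

lemma sgn_mul_self (i j : ι) : D.sgn i j * D.sgn i j = 1 := by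
  by_cases hi : D.odd i
  · by_cases hj : D.odd j
    · simp [D.sgn_odd i j hi hj]
    · simp [D.sgn_comm i j, D.sgn_even j i hj]
  · simp [D.sgn_even i j hi]

/-- A one-dimensional representation `χ` of the subalgebra spanned by the complement of `N`. -/
structure Character where
  N : Set ι
  χ : ι → ℂ
  closed : ∀ i j, i ∉ N → j ∉ N → ∀ k ∈ (D.br i j).1.support, k ∉ N
  char : ∀ i j, i ∉ N → j ∉ N →
    (1 - D.sgn i j) * (χ i * χ j) = ((D.br i j).1.sum fun k a => a * χ k) + (D.br i j).2

variable {D} (C : D.Character) [LinearOrder ι]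

variable (D) in
/-- The letter `i` may stand before the letter `j` in a standard word. -/
def R (i j : ι) : Prop := i < j ∨ i = j ∧ ¬ D.odd i

lemma R_trans {i j k : ι} (h : D.R i j) (h' : D.R j k) : D.R i k := by
  rcases h with h | ⟨rfl, h⟩
  · rcases h' with h' | ⟨rfl, h'⟩
    · exact Or.inl (h.trans h')
    · exact Or.inl h
  · exact h'

namespace Character

/-- Prefixing the letter `i` to the standard word `M` gives a standard word. -/
def ok (i : ι) (M : List ι) : Prop := i ∈ C.N ∧ ∀ j ∈ M, D.R i j

/-- Standard words. -/
def Std (M : List ι) : Prop := M.Pairwise D.R ∧ ∀ i ∈ M, i ∈ C.N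

lemma std_nil : C.Std [] := by simp [Std]

lemma std_cons {i : ι} {M : List ι} : C.Std (i :: M) ↔ C.ok i M ∧ C.Std M := by
  simp only [Std, ok, List.pairwise_cons, List.mem_cons, forall_eq_or_imp]
  tauto

open Classical in
/-- The action of the generators on the span of the words. -/
noncomputable def act : ι → List ι → (List ι →₀ ℂ)
  | i, [] => if i ∈ C.N then single [i] 1 else C.χ i • single [] 1
  | i, j :: M =>
    if C.ok i (j :: M) then single (i :: j :: M) 1 else
    -- On a standard word this case occurs only for odd `i`, whose square is zero.
    if i = j then 0 else
    D.sgn i j • ((act i M).sum fun K a => a •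
        -- The guard makes the recursion well founded. On standard words it does no harm: a term `K`
        -- longer than `M` is a rearrangement of `i :: M`, and the letter `j` may simply be prefixed
        -- to it.
        if K.length < M.length + 1 then act j K else single (j :: K) 1)
      + (((D.br i j).1.sum fun k a => a • act k M) + (D.br i j).2 • single M 1)
termination_by _ M => M.length

/-- The linear extension of `act`. -/
noncomputable def T (i : ι) : Module.End ℂ (List ι →₀ ℂ) := Finsupp.linearCombination ℂ (C.act i)

lemma T_single (i : ι) (M : List ι) : C.T i (single M 1) = C.act i M := by
  simp [T]

lemma act_ok {i : ι} {M : List ι} (h : C.ok i M) : C.act i M = single (i :: M) 1 := by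
  cases M with
  | nil => rw [act, if_pos h.1]
  | cons j M => rw [act, if_pos h]

lemma act_nil_of_notMem {i : ι} (h : i ∉ C.N) : C.act i [] = C.χ i • single [] 1 := by
  rw [act, if_neg h]

omit [LinearOrder ι] in
lemma map_mem_of_supported {α : Type*} {W : Type*} [AddCommGroup W] [Module ℂ W]
    (f : (α →₀ ℂ) →ₗ[ℂ] W) {s : Set α} (S : Submodule ℂ W)
    (h : ∀ K ∈ s, f (single K 1) ∈ S) {y : α →₀ ℂ} (hy : y ∈ supported ℂ ℂ s) : f y ∈ S := by
  rw [supported_eq_span_single] at hy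
  have : Submodule.span ℂ ((fun i => single i (1 : ℂ)) '' s) ≤ S.comap f := by
    rw [Submodule.span_le]
    rintro _ ⟨K, hK, rfl⟩
    exact h K hK
  exact this hy

omit [LinearOrder ι] in
lemma eq_of_supported {α : Type*} {W : Type*} [AddCommGroup W] [Module ℂ W]
    (f g : (α →₀ ℂ) →ₗ[ℂ] W) {s : Set α}
    (h : ∀ K ∈ s, f (single K 1) = g (single K 1)) {y : α →₀ ℂ} (hy : y ∈ supported ℂ ℂ s) :
    f y = g y := by
  have := map_mem_of_supported (f - g) (s := s) ⊥ (fun K hK => by simp [h K hK]) hy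
  simpa [sub_eq_zero] using this

lemma not_ok_cons {i j : ι} {M : List ι} (hs : C.Std (j :: M)) (h : ¬ C.ok i (j :: M))
    (hi : i ∈ C.N) (hij : i ≠ j) : j < i := by
  by_contra hlt
  refine h ⟨hi, fun k hk => ?_⟩
  have h1 : D.R i j := Or.inl (lt_of_le_of_ne (not_lt.1 hlt) hij)
  rcases List.mem_cons.1 hk with rfl | hk
  · exact h1
  · exact R_trans h1 ((C.std_cons.1 hs).1.2 k hk)

/-- The words that may occur in the action of the letter `i` on the word `M`. -/
def shape (i : ι) (M : List ι) : Set (List ι) :=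
  {K | C.Std K ∧ (K.length ≤ M.length ∨ i ∈ C.N ∧ K.Perm (i :: M))}

lemma length_le_of_mem_shape {i : ι} {M K : List ι} (h : K ∈ C.shape i M) :
    K.length ≤ M.length + 1 := by
  rcases h.2 with h | ⟨_, h⟩
  · omega
  · simp [h.length_eq]

lemma ok_of_perm {i j : ι} {M K : List ι} (hj : C.ok j M) (hij : D.R j i)
    (hK : K.Perm (i :: M)) : C.ok j K := by
  refine ⟨hj.1, fun k hk => ?_⟩
  rcases List.mem_cons.1 (hK.mem_iff.1 hk) with rfl | hk
  · exact hij
  · exact hj.2 k hk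

/-- The two claims need each other: removing the guard from `act` uses the shape of the terms for
shorter words, and the shape for `j :: M` is read off from the unguarded recursion. A term of full
length is a rearrangement of `i :: M`, and `j < i`, so `j` may still stand in front. -/
lemma shape_and_rec (n : ℕ) : ∀ (i : ι) (M : List ι), M.length = n → C.Std M →
    C.act i M ∈ supported ℂ ℂ (C.shape i M) ∧ ∀ j M', M = j :: M' → ¬ C.ok i M → i ≠ j →
      C.act i M = D.sgn i j • C.T j (C.act i M') + ev C.T (D.br i j) (single M' 1) := by
  induction n using Nat.strong_induction_on with
  | _ n ih =>
  intro i M hn hM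
  cases M with
  | nil =>
    refine ⟨?_, by simp⟩
    by_cases hi : i ∈ C.N
    · rw [C.act_ok ⟨hi, by simp⟩]
      refine single_mem_supported _ _ ⟨?_, Or.inr ⟨hi, List.Perm.refl _⟩⟩
      exact C.std_cons.2 ⟨⟨hi, by simp⟩, C.std_nil⟩
    · rw [C.act_nil_of_notMem hi]
      exact Submodule.smul_mem _ _ (single_mem_supported _ _ ⟨C.std_nil, Or.inl le_rfl⟩)
  | cons j M =>
    simp only [List.length_cons] at hn
    obtain ⟨hj, hM'⟩ := C.std_cons.1 hM
    have ihM := fun k => (ih M.length (by omega) k M rfl hM').1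
    have key : ¬ C.ok i (j :: M) → i ≠ j →
        C.act i (j :: M) = D.sgn i j • C.T j (C.act i M) + ev C.T (D.br i j) (single M 1) := by
      intro hok hij
      rw [act, if_neg hok, if_neg hij]
      congr 1
      · congr 1
        rw [T, Finsupp.linearCombination_apply]
        refine Finsupp.sum_congr fun K hK => ?_
        congr 1
        split_ifs with hl
        · rfl
        · have hK' := (mem_supported _ _).1 (ihM i) hK
          rcases hK'.2 with h | ⟨hi, h⟩
          · omega
          · rw [C.act_ok]
            exact C.ok_of_perm hj (Or.inl (C.not_ok_cons hM hok hi hij)) h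
      · rw [ev_end_apply]
        simp only [T_single]
    refine ⟨?_, fun j' M'' h hok hij => ?_⟩
    · by_cases hok : C.ok i (j :: M)
      · rw [C.act_ok hok]
        exact single_mem_supported _ _
          ⟨C.std_cons.2 ⟨hok, hM⟩, Or.inr ⟨hok.1, List.Perm.refl _⟩⟩
      by_cases hij : i = j
      · rw [act, if_neg hok, if_pos hij]
        exact Submodule.zero_mem _
      rw [key hok hij]
      have hshort : supported ℂ ℂ {K | C.Std K ∧ K.length ≤ M.length + 1} ≤
          supported ℂ ℂ (C.shape i (j :: M)) :=
        supported_mono fun K hK => ⟨hK.1, Or.inl hK.2⟩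
      have hsub : ∀ k, C.act k M ∈ supported ℂ ℂ (C.shape i (j :: M)) := fun k =>
        hshort (supported_mono (t := {K | C.Std K ∧ K.length ≤ M.length + 1})
          (fun K hK => ⟨hK.1, C.length_le_of_mem_shape hK⟩) (ihM k))
      refine Submodule.add_mem _ (Submodule.smul_mem _ _ ?_) ?_
      · refine map_mem_of_supported (C.T j) _ (fun K hK => ?_) (ihM i)
        rw [T_single]
        rcases hK.2 with h | ⟨hi, h⟩
        · exact hshort (supported_mono (t := {K | C.Std K ∧ K.length ≤ M.length + 1})
            (fun K' hK' => ⟨hK'.1, (C.length_le_of_mem_shape hK').trans (by omega)⟩)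
            (ih K.length (by omega) j K rfl hK.1).1)
        · have hokK := C.ok_of_perm hj (Or.inl (C.not_ok_cons hM hok hi hij)) h
          rw [C.act_ok hokK]
          refine single_mem_supported _ _ ⟨C.std_cons.2 ⟨hokK, hK.1⟩, Or.inr ⟨hi, ?_⟩⟩
          exact (List.Perm.cons j h).trans (List.Perm.swap _ _ _)
      · rw [ev_end_apply]
        refine Submodule.add_mem _ (Submodule.sum_mem _ fun k _ => ?_) ?_
        · simp only [T_single]
          exact Submodule.smul_mem _ _ (hsub k)
        · exact Submodule.smul_mem _ _
            (single_mem_supported _ _ ⟨hM', Or.inl (by simp)⟩)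
    · obtain ⟨rfl, rfl⟩ := List.cons.inj h
      exact key hok hij

lemma act_mem_shape {i : ι} {M : List ι} (hM : C.Std M) :
    C.act i M ∈ supported ℂ ℂ (C.shape i M) := (C.shape_and_rec _ i M rfl hM).1

lemma act_cons {i j : ι} {M : List ι} (hM : C.Std (j :: M)) (hok : ¬ C.ok i (j :: M))
    (hij : i ≠ j) : C.act i (j :: M) =
      D.sgn i j • C.T j (C.act i M) + ev C.T (D.br i j) (single M 1) :=
  (C.shape_and_rec _ i _ rfl hM).2 j M rfl hok hij

lemma act_cons_self {j : ι} {M : List ι} (hok : ¬ C.ok j (j :: M)) : C.act j (j :: M) = 0 := by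
  rw [act, if_neg hok, if_pos rfl]

/-- The operators of `i` and `j` have the right supercommutator on `y`. -/
def Comm (i j : ι) (y : List ι →₀ ℂ) : Prop :=
  C.T i (C.T j y) - D.sgn i j • C.T j (C.T i y) = ev C.T (D.br i j) y

lemma Comm.symm {i j : ι} {y : List ι →₀ ℂ} (h : C.Comm i j y) : C.Comm j i y := by
  unfold Comm at *
  rw [D.skew i j, map_neg, map_smul, LinearMap.neg_apply, LinearMap.smul_apply, ← h,
    D.sgn_comm j i, smul_sub, smul_smul, D.sgn_mul_self]
  module

lemma comm_of_supported {i j : ι} {s : Set (List ι)} (h : ∀ K ∈ s, C.Comm i j (single K 1))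
    {y : List ι →₀ ℂ} (hy : y ∈ supported ℂ ℂ s) : C.Comm i j y :=
  eq_of_supported (C.T i ∘ₗ C.T j - D.sgn i j • (C.T j ∘ₗ C.T i)) (ev C.T (D.br i j)) h hy

/-- The commutation relation holds if one of the letters may be prefixed. -/
lemma comm_of_ok {i k : ι} {K : List ι} (hK : C.Std K) (hk : C.ok k K) :
    C.Comm i k (single K 1) := by
  have aux : ∀ {i k : ι}, C.ok k K → i ≠ k → ¬ C.ok i (k :: K) → C.Comm i k (single K 1) := by
    intro i k hk hik hok
    unfold Comm
    rw [T_single, T_single, C.act_ok hk, T_single, C.act_cons (C.std_cons.2 ⟨hk, hK⟩) hok hik]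
    module
  by_cases hik : i = k
  · subst hik
    unfold Comm
    rw [D.self, map_zero, LinearMap.zero_apply]
    by_cases ho : D.odd i
    · rw [T_single, C.act_ok hk, T_single, C.act_cons_self]
      · simp
      · intro h
        rcases h.2 i (by simp) with h | h
        · exact lt_irrefl _ h
        · exact h.2 ho
    · rw [D.sgn_even i i ho]; simp
  by_cases hok : C.ok i (k :: K)
  · have h1 : D.R i k := hok.2 k (by simp)
    refine Comm.symm C (aux ⟨hok.1, fun l hl => hok.2 l (by simp [hl])⟩ (Ne.symm hik) ?_)
    intro h
    have h2 : D.R k i := h.2 i (by simp)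
    rcases h1 with h1 | h1
    · rcases h2 with h2 | h2
      · exact lt_asymm h1 h2
      · exact hik h2.1.symm
    · exact hik h1.1
  · exact aux hk hik hok

/-- Moves the letter `j` past the bracket of `i` and `k` at the price of the double bracket.
Commutation is assumed on `z` only, which is what the induction provides. The scalar part of the
bracket passes freely because it is nonzero only when `i` and `k` have equal signs against every
letter. -/
lemma ev_br_T {i k j : ι} {z : List ι →₀ ℂ} (h : ∀ l, C.Comm l j z) :
    ev C.T (D.br i k) (C.T j z) = (D.sgn i j * D.sgn k j) • C.T j (ev C.T (D.br i k) z)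
      + ev C.T ((D.br i k).1.sum fun l a => a • D.br l j) z := by
  have h2 : (D.br i k).2 • C.T j z =
      ((D.br i k).2 * (D.sgn i j * D.sgn k j)) • C.T j z := by
    by_cases hz : (D.br i k).2 = 0
    · simp [hz]
    · rw [D.sgn_sc i k hz j, D.sgn_mul_self, mul_one]
  rw [ev_end_apply, ev_end_apply, h2, map_add, map_smul, smul_add, smul_smul, Finsupp.sum,
    Finsupp.sum, Finsupp.sum, map_sum, map_sum, LinearMap.sum_apply, Finset.smul_sum,
    add_right_comm, ← Finset.sum_add_distrib, mul_comm (D.br i k).2]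
  congr 1
  refine Finset.sum_congr rfl fun l hl => ?_
  have := h l
  unfold Comm at this
  rw [map_smul, map_smul, LinearMap.smul_apply, ← this, D.sgn_br i k l hl j]
  module

lemma not_ok_cases {i k : ι} {M : List ι} (hs : C.Std (k :: M)) (h : ¬ C.ok i (k :: M)) :
    i ∉ C.N ∨ D.R k i ∨ i = k ∧ D.odd k := by
  by_cases hi : i ∈ C.N
  · by_cases hik : i = k
    · by_cases ho : D.odd k
      · exact Or.inr (Or.inr ⟨hik, ho⟩)
      · exact Or.inr (Or.inl (Or.inr ⟨hik.symm, ho⟩))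
    · exact Or.inr (Or.inl (Or.inl (C.not_ok_cons hs h hi hik)))
  · exact Or.inl hi

/-- The operators `T` satisfy the relations of the superalgebra. -/
theorem comm_single (n : ℕ) : ∀ M : List ι, M.length = n → C.Std M →
    ∀ i j, C.Comm i j (single M 1) := by
  induction n using Nat.strong_induction_on with
  | _ n ih =>
  intro M hn hM i j
  by_cases hj : C.ok j M
  · exact C.comm_of_ok hM hj
  by_cases hi : C.ok i M
  · exact (C.comm_of_ok hM hi).symm
  cases M with
  | nil =>
    have hi' : i ∉ C.N := fun h => hi ⟨h, by simp⟩
    have hj' : j ∉ C.N := fun h => hj ⟨h, by simp⟩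
    unfold Comm
    rw [ev_end_apply, T_single, T_single, C.act_nil_of_notMem hi', C.act_nil_of_notMem hj',
      map_smul, map_smul, T_single, T_single, C.act_nil_of_notMem hi', C.act_nil_of_notMem hj']
    have : ((D.br i j).1.sum fun k a => a • C.T k (single [] 1)) =
        ((D.br i j).1.sum fun k a => a * C.χ k) • single [] 1 := by
      rw [Finsupp.sum, Finsupp.sum, Finset.sum_smul]
      refine Finset.sum_congr rfl fun k hk => ?_
      rw [T_single, C.act_nil_of_notMem (C.closed i j hi' hj' k hk), smul_smul]
    rw [this, ← add_smul, ← C.char i j hi' hj']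
    module
  | cons k M =>
    simp only [List.length_cons] at hn
    obtain ⟨hk, hM'⟩ := C.std_cons.1 hM
    have hz : ∀ a b, C.Comm a b (single M 1) := ih M.length (by omega) M rfl hM'
    have hzM : C.T k (single M 1) = single (k :: M) 1 := by rw [T_single, C.act_ok hk]
    -- The terms of `act b M` are either short, hence covered by the induction, or rearrangements of
    -- `b :: M`, to which `k` may be prefixed.
    have hT : ∀ a b, ¬ C.ok b (k :: M) → ¬ (b = k ∧ D.odd k) →
        C.Comm a k (C.T b (single M 1)) := by
      intro a b hb hbk
      rw [T_single]
      refine C.comm_of_supported (fun K hK => ?_) (C.act_mem_shape hM')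
      rcases hK.2 with h | ⟨hb', h⟩
      · exact ih K.length (by omega) K rfl hK.1 _ _
      · refine C.comm_of_ok hK.1 (C.ok_of_perm hk ?_ h)
        rcases C.not_ok_cases hM hb with h | h | h
        · exact absurd hb' h
        · exact h
        · exact absurd h hbk
    -- The case that `hT` leaves out: the first letter `k` is odd and is one of the two letters. The
    -- Jacobi identity for `a, k, k` makes the double bracket vanish, and `hT` with both letters
    -- equal to `k` gives that `k` squares to zero on `C.T a (single M 1)`.
    have hodd : ∀ a, ¬ C.ok a (k :: M) → D.odd k → C.Comm a k (single (k :: M) 1) := by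
      intro a ha ho
      have hkk : C.T k (single (k :: M) 1) = 0 := by
        rw [T_single, C.act_cons_self]
        intro h
        rcases h.2 k (by simp) with h | h
        · exact lt_irrefl _ h
        · exact h.2 ho
      by_cases hak : a = k
      · subst hak
        unfold Comm
        rw [hkk, D.self]; simp
      have h1 := hz a k
      have h2 := hT k a ha (fun h => hak h.1)
      have h3 := C.ev_br_T (i := a) (k := k) (fun l => hz l k)
      have hJ := D.jacobi a k k
      rw [D.self, D.sgn_odd k k ho ho] at hJ
      have hJ0 : ((D.br a k).1.sum fun l b => b • D.br l k) = 0 := by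
        have h2 : (2 : ℂ) • ((D.br a k).1.sum fun l b => b • D.br l k) = 0 := by
          simp only [Prod.fst_zero, Finsupp.sum_zero_index, smul_zero, sub_zero] at hJ
          linear_combination (norm := module) hJ
        exact (smul_eq_zero.1 h2).resolve_left two_ne_zero
      unfold Comm at h1 h2 ⊢
      rw [hJ0, map_zero, LinearMap.zero_apply, add_zero, D.sgn_odd k k ho ho] at h3
      rw [D.self, map_zero, LinearMap.zero_apply, D.sgn_odd k k ho ho] at h2
      have h2' : C.T k (C.T k (C.T a (single M 1))) = 0 := by
        have : (2 : ℂ) • C.T k (C.T k (C.T a (single M 1))) = 0 := by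
          rw [← h2]; module
        exact (smul_eq_zero.1 this).resolve_left two_ne_zero
      rw [hkk, map_zero, ← hzM, h3, ← h1, map_sub, map_smul, h2']
      module
    by_cases hjk : j = k ∧ D.odd k
    · obtain ⟨rfl, ho⟩ := hjk
      exact hodd i hi ho
    by_cases hik : i = k ∧ D.odd k
    · obtain ⟨rfl, ho⟩ := hik
      exact (hodd j hj ho).symm
    have h1 := hz j k
    have h2 := hT i j hj hjk
    have h3 := hT j i hi hik
    have h4 := hz i k
    have h5 := congrArg (C.T k) (hz i j)
    have h6 := C.ev_br_T (i := i) (k := j) (fun l => hz l k)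
    have h7 := C.ev_br_T (i := i) (k := k) (fun l => hz l j)
    have h8 := C.ev_br_T (i := j) (k := k) (fun l => hz l i)
    rw [D.jacobi i j k, map_sub, map_smul, map_smul] at h6
    rw [← hzM]
    unfold Comm at h1 h2 h3 h4 ⊢
    have h1' := congrArg (C.T i) h1
    have h4' := congrArg (C.T j) h4
    rw [D.sgn_comm k j] at h7
    rw [D.sgn_comm j i, D.sgn_comm k i] at h8
    simp only [map_sub, map_smul, LinearMap.sub_apply, LinearMap.smul_apply] at *
    have e1 := D.sgn_mul_self i j
    have e2 := D.sgn_mul_self i k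
    have e3 := D.sgn_mul_self j k
    -- The diamond check: `i` and `j` are moved past `k` on both sides, and the three double
    -- brackets cancel by the Jacobi identity already substituted in `h6`. The terms with `e1`,
    -- `e2`, `e3` remove squares of signs.
    linear_combination (norm := module) h1' + D.sgn j k • h2 - D.sgn i j • h4'
      - (D.sgn i j * D.sgn i k) • h3 + (D.sgn j k * D.sgn i k) • h5 - h6 + D.sgn j k • h7
      - (D.sgn i j * D.sgn i k) • h8
      + e3 • (D.sgn i j • C.T j (ev C.T (D.br i k) (single M 1)))
      - e1 • C.T i (ev C.T (D.br j k) (single M 1))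
      - e2 • ((D.sgn i j * D.sgn i j) • C.T i (ev C.T (D.br j k) (single M 1)))

end Character

end SuperLie

/-! ### Structure constants of the twisted N = 2 algebra -/

open Finsupp

namespace Gen

/-- The odd modes. -/
def Odd : Gen → Prop
  | L _ => False
  | H _ => False
  | Q _ => True
  | G _ => True

/-- The sign in the supercommutator of two modes. -/
def sgn : Gen → Gen → ℂ
  | L _, _ => 1
  | H _, _ => 1
  | _, L _ => 1
  | _, H _ => 1
  | _, _ => -1

/-- The supercommutator of two modes. -/
noncomputable def br (c : ℂ) : Gen → Gen → (Gen →₀ ℂ) × ℂ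
  | L m, L n => (((m : ℂ) - n) • single (L (m + n)) 1, 0)
  | H m, H n => (0, c / 3 * m * delta (m + n))
  | L m, G n => (((m : ℂ) - n) • single (G (m + n)) 1, 0)
  | G m, L n => (((m : ℂ) - n) • single (G (m + n)) 1, 0)
  | H m, G n => (single (G (m + n)) 1, 0)
  | G m, H n => (-single (G (m + n)) 1, 0)
  | L m, Q n => ((-(n : ℂ)) • single (Q (m + n)) 1, 0)
  | Q m, L n => ((m : ℂ) • single (Q (m + n)) 1, 0)
  | H m, Q n => (-single (Q (m + n)) 1, 0)
  | Q m, H n => (single (Q (m + n)) 1, 0)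
  | L m, H n => ((-(n : ℂ)) • single (H (m + n)) 1, c / 6 * ((m : ℂ) ^ 2 + m) * delta (m + n))
  | H m, L n => ((m : ℂ) • single (H (m + n)) 1, -(c / 6 * ((n : ℂ) ^ 2 + n) * delta (m + n)))
  | G m, Q n => ((2 : ℂ) • single (L (m + n)) 1 - (2 * (n : ℂ)) • single (H (m + n)) 1,
      c / 3 * ((m : ℂ) ^ 2 + m) * delta (m + n))
  | Q m, G n => ((2 : ℂ) • single (L (m + n)) 1 - (2 * (m : ℂ)) • single (H (m + n)) 1,
      c / 3 * ((n : ℂ) ^ 2 + n) * delta (m + n))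
  | G _, G _ => (0, 0)
  | Q _, Q _ => (0, 0)

/-- The index of a mode. -/
def idx : Gen → ℤ
  | L n => n
  | H n => n
  | Q n => n
  | G n => n

/-- The `U(1)` charge of a mode. -/
def ch : Gen → ℤ
  | L _ => 0
  | H _ => 0
  | Q _ => -1
  | G _ => 1

lemma mem_support_br {c : ℂ} {i j k : Gen} (h : k ∈ (br c i j).1.support) :
    k.idx = i.idx + j.idx ∧ k.ch = i.ch + j.ch := by
  classical
  rw [Finsupp.mem_support_iff] at h
  cases i <;> cases j <;> simp only [br, Finsupp.smul_apply, Finsupp.sub_apply, Finsupp.neg_apply,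
    Finsupp.coe_zero, Pi.zero_apply, ne_eq, not_true_eq_false] at h
  all_goals
    cases k <;> simp [idx, ch, Finsupp.single_apply] at h ⊢ <;> (try tauto)

lemma br_snd_ne_zero {c : ℂ} {i j : Gen} (h : (br c i j).2 ≠ 0) :
    i.idx + j.idx = 0 ∧ i.ch + j.ch = 0 := by
  cases i <;> cases j <;> simp only [br, ne_eq, not_true_eq_false] at h
  all_goals
    simp only [idx, ch, delta] at h ⊢
    split_ifs at h with h0 <;> simp_all

set_option maxHeartbeats 2000000 in
lemma jacobi_br (c : ℂ) (i j k : Gen) :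
    Finsupp.linearCombination ℂ (fun l => br c l k) (br c i j).1 =
      sgn j k • Finsupp.linearCombination ℂ (fun l => br c l j) (br c i k).1
        - (sgn i j * sgn i k) • Finsupp.linearCombination ℂ (fun l => br c l i) (br c j k).1 := by
  cases i with
  | _ a =>
  cases j with
  | _ b =>
  cases k with
  | _ d =>
  have e1 : a + b + d = b + d + a := by ring
  have e2 : a + d + b = b + d + a := by ring
  ext1
  · simp only [br, sgn, map_sub, map_neg, map_smul, map_zero,
      Finsupp.linearCombination_single, one_smul, e1, e2, Prod.fst_sub, Prod.smul_fst,
      Prod.fst_neg, Prod.fst_zero]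
    push_cast
    module
  · simp only [br, sgn, map_sub, map_neg, map_smul, map_zero,
      Finsupp.linearCombination_single, one_smul, e1, e2, Prod.snd_sub, Prod.smul_snd,
      Prod.snd_neg, Prod.snd_zero, smul_eq_mul]
    -- All central terms carry the delta of the total index; on its support they are polynomials in
    -- `a` and `b`.
    by_cases h : b + d + a = 0
    · have hd : d = -a - b := by linarith
      subst hd
      push_cast
      ring
    · simp [delta, h]

end Gen

/-- The structure constants of the twisted `N = 2` superconformal algebra. -/
noncomputable def superData (c : ℂ) : SuperLie Gen where
  odd := Gen.Odd
  sgn := Gen.sgn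
  br := Gen.br c
  sgn_even i j h := by
    cases i <;> cases j <;> simp_all [Gen.Odd, Gen.sgn]
  sgn_odd i j hi hj := by
    cases i <;> cases j <;> simp_all [Gen.Odd, Gen.sgn]
  sgn_comm i j := by
    cases i <;> cases j <;> rfl
  skew i j := by
    cases i with
    | _ a =>
    cases j with
    | _ b =>
    ext1
    · simp only [Gen.br, Gen.sgn, add_comm b a, Prod.fst_neg, Prod.smul_fst]
      module
    · simp only [Gen.br, Gen.sgn, add_comm b a, Prod.snd_neg, Prod.smul_snd, smul_eq_mul]
      by_cases h : a + b = 0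
      · have hd : b = -a := by linarith
        subst hd
        push_cast
        ring
      · simp [delta, h]
  self i := by
    cases i <;> simp only [Gen.br, sub_self, zero_smul, Prod.mk_zero_zero]
    rename_i m
    by_cases h : m + m = 0
    · have : m = 0 := by omega
      simp [this]
    · simp [delta, h]
  sgn_br i j k hk l := by
    have := (Gen.mem_support_br hk).2
    cases i <;> cases j <;> cases k <;> cases l <;> simp_all [Gen.sgn, Gen.ch]
  sgn_sc i j h l := by
    have := (Gen.br_snd_ne_zero h).2
    cases i <;> cases j <;> cases l <;> simp_all [Gen.sgn, Gen.ch]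
  jacobi i j k := by
    simpa only [Finsupp.linearCombination_apply] using Gen.jacobi_br c i j k

/-! ### The enveloping algebra in terms of structure constants -/

open Finsupp

/-- The image of a mode in the enveloping algebra. -/
noncomputable def mode (c : ℂ) (g : Gen) : Alg c :=
  RingQuot.mkAlgHom ℂ (Rel c) (FreeAlgebra.ι ℂ g)

lemma mode_L (c : ℂ) (n : ℤ) : mode c (.L n) = L c n := rfl
lemma mode_H (c : ℂ) (n : ℤ) : mode c (.H n) = H c n := rfl
lemma mode_Q (c : ℂ) (n : ℤ) : mode c (.Q n) = Q c n := rfl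
lemma mode_G (c : ℂ) (n : ℤ) : mode c (.G n) = G c n := rfl

/-- `Rel` lists only one order of each mixed pair of types. The other order is recovered through
`flip` from super skew-symmetry. -/
lemma comm_of_rel {c : ℂ} {A : Type*} [Ring A] [Algebra ℂ A] (f : Free →ₐ[ℂ] A)
    (hf : ∀ {a b : Free}, Rel c a b → f a = f b) (i j : Gen) :
    f (FreeAlgebra.ι ℂ i) * f (FreeAlgebra.ι ℂ j)
      - (superData c).sgn i j • (f (FreeAlgebra.ι ℂ j) * f (FreeAlgebra.ι ℂ i)) =
      ev (fun g => f (FreeAlgebra.ι ℂ g)) ((superData c).br i j) := by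
  set X : Gen → A := fun g => f (FreeAlgebra.ι ℂ g) with hX
  have flip : ∀ i j : Gen, X j * X i - (superData c).sgn j i • (X i * X j) =
      ev X ((superData c).br j i) →
      X i * X j - (superData c).sgn i j • (X j * X i) = ev X ((superData c).br i j) := by
    intro i j h
    rw [(superData c).skew j i, map_neg, map_smul, ← h, smul_sub, smul_smul,
      (superData c).sgn_mul_self, (superData c).sgn_comm i j]
    module
  have LG : ∀ m n : ℤ, _ := fun m n => hf (Rel.LG m n)
  have LQ : ∀ m n : ℤ, _ := fun m n => hf (Rel.LQ m n)
  have LH : ∀ m n : ℤ, _ := fun m n => hf (Rel.LH m n)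
  have HG : ∀ m n : ℤ, _ := fun m n => hf (Rel.HG m n)
  have HQ : ∀ m n : ℤ, _ := fun m n => hf (Rel.HQ m n)
  have GQ : ∀ m n : ℤ, _ := fun m n => hf (Rel.GQ m n)
  have LL : ∀ m n : ℤ, _ := fun m n => hf (Rel.LL m n)
  have HH : ∀ m n : ℤ, _ := fun m n => hf (Rel.HH m n)
  have GG : ∀ m n : ℤ, _ := fun m n => hf (Rel.GG m n)
  have QQ : ∀ m n : ℤ, _ := fun m n => hf (Rel.QQ m n)
  simp only [Algebra.algebraMap_eq_smul_one] at LG LQ LH HG HQ GQ LL HH GG QQ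
  simp only [map_sub, map_mul, map_smul, map_neg, map_add, map_zero, map_one, neg_smul]
    at LG LQ LH HG HQ GQ LL HH GG QQ
  change X i * X j - (superData c).sgn i j • (X j * X i) = ev X ((superData c).br i j)
  simp only [ev_apply] at flip ⊢
  cases i <;> cases j <;> first
    | (simp only [superData, Gen.br, Gen.sgn, one_smul, neg_smul, sub_neg_eq_add,
        ← Finsupp.linearCombination_apply, map_sub, map_smul, map_neg, map_zero,
        Finsupp.linearCombination_single, zero_smul, add_zero, zero_add]
       first | exact LL _ _ | exact HH _ _ | exact LG _ _ | exact HG _ _ | exact LQ _ _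
             | exact HQ _ _ | exact LH _ _ | exact GQ _ _ | exact GG _ _ | exact QQ _ _)
    | (apply flip
       simp only [superData, Gen.br, Gen.sgn, one_smul, neg_smul, sub_neg_eq_add,
        ← Finsupp.linearCombination_apply, map_sub, map_smul, map_neg,
        Finsupp.linearCombination_single, zero_smul, add_zero]
       first | exact LG _ _ | exact HG _ _ | exact LQ _ _
             | exact HQ _ _ | exact LH _ _ | exact GQ _ _)

lemma mode_comm (c : ℂ) (i j : Gen) :
    mode c i * mode c j - (superData c).sgn i j • (mode c j * mode c i) =
      ev (mode c) ((superData c).br i j) :=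
  comm_of_rel (RingQuot.mkAlgHom ℂ (Rel c)) (fun h => RingQuot.mkAlgHom_rel ℂ h) i j

/-- Modules over the enveloping algebra from operators that satisfy the relations. -/
lemma exists_algHom {P : Type*} [AddCommGroup P] [Module ℂ P] (c : ℂ)
    (X : Gen → Module.End ℂ P)
    (hX : ∀ i j, X i * X j - (superData c).sgn i j • (X j * X i) = ev X ((superData c).br i j)) :
    ∃ ρ : Alg c →ₐ[ℂ] Module.End ℂ P, ∀ i, ρ (mode c i) = X i := by
  have hr : ∀ ⦃a b : Free⦄, Rel c a b → FreeAlgebra.lift ℂ X a = FreeAlgebra.lift ℂ X b := by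
    intro a b h
    induction h with
    | LL m n => ?_
    | HH m n => ?_
    | LG m n => ?_
    | HG m n => ?_
    | LQ m n => ?_
    | HQ m n => ?_
    | LH m n => ?_
    | GQ m n => ?_
    | GG m n => ?_
    | QQ m n => ?_
    all_goals
      try simp only [Algebra.algebraMap_eq_smul_one]
      simp only [map_sub, map_mul, map_smul, map_neg, map_add, map_zero, map_one, Free.L, Free.H, Free.Q, Free.G, FreeAlgebra.lift_ι_apply]
    on_goal 1 => have h := hX (.L m) (.L n)
    on_goal 2 => have h := hX (.H m) (.H n)
    on_goal 3 => have h := hX (.L m) (.G n)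
    on_goal 4 => have h := hX (.H m) (.G n)
    on_goal 5 => have h := hX (.L m) (.Q n)
    on_goal 6 => have h := hX (.H m) (.Q n)
    on_goal 7 => have h := hX (.L m) (.H n)
    on_goal 8 => have h := hX (.G m) (.Q n)
    on_goal 9 => have h := hX (.G m) (.G n)
    on_goal 10 => have h := hX (.Q m) (.Q n)
    all_goals
      simp only [ev_apply, superData, Gen.br, Gen.sgn, one_smul, neg_smul,
        sub_neg_eq_add, ← Finsupp.linearCombination_apply, map_sub, map_smul, map_neg, map_zero,
        Finsupp.linearCombination_single, zero_smul, add_zero, zero_add] at h ⊢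
      exact h
  refine ⟨RingQuot.liftAlgHom ℂ ⟨FreeAlgebra.lift ℂ X, hr⟩, fun i => ?_⟩
  rw [mode, RingQuot.liftAlgHom_mkAlgHom_apply, FreeAlgebra.lift_ι_apply]

/-- A subspace closed under all modes is closed under the enveloping algebra. -/
lemma smul_mem_of_mode {c : ℂ} {M : Type*} [AddCommGroup M] [Module ℂ M] [Module (Alg c) M]
    [IsScalarTower ℂ (Alg c) M] (S : Submodule ℂ M)
    (h : ∀ i, ∀ x ∈ S, mode c i • x ∈ S) (a : Alg c) : ∀ x ∈ S, a • x ∈ S := by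
  obtain ⟨a, rfl⟩ := RingQuot.mkAlgHom_surjective ℂ (Rel c) a
  induction a using FreeAlgebra.induction with
  | grade0 r =>
    intro x hx
    rw [AlgHom.commutes, algebraMap_smul]
    exact S.smul_mem _ hx
  | grade1 i => exact h i
  | mul a b ha hb =>
    intro x hx
    rw [map_mul, mul_smul]
    exact ha _ (hb x hx)
  | add a b ha hb =>
    intro x hx
    rw [map_add, add_smul]
    exact S.add_mem (ha x hx) (hb x hx)

/-! ### Induced modules and the Poincaré–Birkhoff–Witt theorem -/

open Finsupp

/-- The product of the modes of a word. -/
noncomputable def word (c : ℂ) (W : List Gen) : Alg c := (W.map (mode c)).prod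

lemma word_cons (c : ℂ) (i : Gen) (W : List Gen) : word c (i :: W) = mode c i * word c W := by
  simp [word]

namespace SuperLie.Character

section Module

variable {c : ℂ} (C : (superData c).Character)
  {M : Type*} [AddCommGroup M] [Module ℂ M] [Module (Alg c) M] [IsScalarTower ℂ (Alg c) M]

/-- The vector `v` transforms by the character `C`. -/
def IsHW (v : M) : Prop := ∀ i, i ∉ C.N → mode c i • v = C.χ i • v

/-- The linear map from the span of the words to a module that applies words to a vector. -/
noncomputable def toMod (c : ℂ) {M : Type*} [AddCommGroup M] [Module ℂ M] [Module (Alg c) M]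
    (v : M) : (List Gen →₀ ℂ) →ₗ[ℂ] M :=
  Finsupp.linearCombination ℂ fun W => word c W • v

omit [IsScalarTower ℂ (Alg c) M] in
lemma toMod_single (v : M) (W : List Gen) : toMod c v (single W 1) = word c W • v := by
  simp [toMod]

lemma mode_comm_smul (i j : Gen) (x : M) :
    mode c i • mode c j • x - (superData c).sgn i j • mode c j • mode c i • x =
      (((superData c).br i j).1.sum fun k a => a • mode c k • x)
        + ((superData c).br i j).2 • x := by
  have h := congrArg (· • x) (mode_comm c i j)
  simpa only [ev_apply, sub_smul, mul_smul, smul_assoc, add_smul, one_smul, Finsupp.sum,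
    Finset.sum_smul] using h

variable [LinearOrder Gen]

/-- The span of the standard words. -/
noncomputable def stdSub : Submodule ℂ (List Gen →₀ ℂ) := supported ℂ ℂ {W | C.Std W}

lemma single_mem_stdSub {W : List Gen} (h : C.Std W) : single W 1 ∈ C.stdSub :=
  single_mem_supported _ _ h

lemma T_mem_stdSub {i : Gen} {y : List Gen →₀ ℂ} (hy : y ∈ C.stdSub) : C.T i y ∈ C.stdSub :=
  map_mem_of_supported (C.T i) _ (fun K hK => by
    rw [T_single]
    exact supported_mono (fun _ h => h.1) (C.act_mem_shape hK)) hy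

lemma comm_of_mem_stdSub {y : List Gen →₀ ℂ} (hy : y ∈ C.stdSub) (i j : Gen) : C.Comm i j y :=
  C.comm_of_supported (fun K hK => C.comm_single _ K rfl hK i j) hy

/-- The recursion that defines `act` is forced by the supercommutators in any module with a vector
of this type, so induction on the length compares the two actions term by term. -/
lemma toMod_act {v : M} (hv : C.IsHW v) (n : ℕ) : ∀ (i : Gen) (W : List Gen), W.length = n →
    C.Std W → toMod c v (C.act i W) = mode c i • toMod c v (single W 1) := by
  induction n using Nat.strong_induction_on with
  | _ n ih =>
  intro i W hn hW
  by_cases hok : C.ok i W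
  · rw [C.act_ok hok, toMod_single, toMod_single, word_cons, mul_smul]
  cases W with
  | nil =>
    have hi : i ∉ C.N := fun h => hok ⟨h, by simp⟩
    rw [C.act_nil_of_notMem hi, map_smul, toMod_single]
    simpa [word] using (hv i hi).symm
  | cons j W =>
    simp only [List.length_cons] at hn
    obtain ⟨hj, hW'⟩ := C.std_cons.1 hW
    have hcomm := mode_comm_smul (c := c) i j (word c W • v)
    by_cases hij : i = j
    · subst hij
      have ho : (superData c).odd i := by
        by_contra ho
        refine hok ⟨hj.1, fun k hk => ?_⟩
        rcases List.mem_cons.1 hk with rfl | hk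
        · exact Or.inr ⟨rfl, ho⟩
        · exact hj.2 k hk
      rw [(superData c).sgn_odd i i ho ho, (superData c).self] at hcomm
      have h0 : (2 : ℂ) • mode c i • mode c i • word c W • v = 0 := by
        simp only [Prod.fst_zero, Prod.snd_zero, Finsupp.sum_zero_index, zero_smul,
          add_zero, neg_smul, one_smul, sub_neg_eq_add] at hcomm
        rw [two_smul, hcomm]
      rw [C.act_cons_self hok, toMod_single, word_cons, mul_smul, map_zero]
      exact ((smul_eq_zero.1 h0).resolve_left two_ne_zero).symm
    · have h1 : toMod c v (C.T j (C.act i W)) = mode c j • toMod c v (C.act i W) := by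
        refine eq_of_supported (toMod c v ∘ₗ C.T j)
          ((Module.toModuleEnd ℂ (S := Alg c) M (mode c j)) ∘ₗ toMod c v)
          (fun K hK => ?_) (C.act_mem_shape hW')
        simp only [LinearMap.comp_apply, T_single, Module.toModuleEnd_apply,
          DistribSMul.toLinearMap_apply]
        rcases hK.2 with h | ⟨hi, h⟩
        · exact ih K.length (by omega) j K rfl hK.1
        · rw [C.act_ok (C.ok_of_perm hj (Or.inl (C.not_ok_cons hW hok hi hij)) h),
            toMod_single, toMod_single, word_cons, mul_smul]
      rw [C.act_cons hW hok hij, map_add, map_smul, h1, ih W.length (by omega) i W rfl hW',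
        toMod_single, toMod_single, word_cons, mul_smul, ev_end_apply, map_add, map_smul,
        toMod_single, Finsupp.sum, map_sum]
      simp only [map_smul, T_single]
      rw [Finset.sum_congr rfl fun k _ => by rw [ih W.length (by omega) k W rfl hW', toMod_single]]
      rw [Finsupp.sum] at hcomm
      rw [← hcomm, add_sub_cancel]

lemma toMod_T {v : M} (hv : C.IsHW v) (i : Gen) {y : List Gen →₀ ℂ} (hy : y ∈ C.stdSub) :
    toMod c v (C.T i y) = mode c i • toMod c v y := by
  refine eq_of_supported (toMod c v ∘ₗ C.T i)
    ((Module.toModuleEnd ℂ (S := Alg c) M (mode c i)) ∘ₗ toMod c v) (fun K hK => ?_) hy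
  simp only [LinearMap.comp_apply, T_single, Module.toModuleEnd_apply,
    DistribSMul.toLinearMap_apply]
  exact C.toMod_act hv _ i K rfl hK

/-- The module is freely generated from `v` by the standard words. -/
structure IsFree (v : M) : Prop where
  hw : C.IsHW v
  inj : ∀ y ∈ C.stdSub, toMod c v y = 0 → y = 0
  surj : ∀ u, ∃ y ∈ C.stdSub, toMod c v y = u

end Module

variable {c : ℂ} (C : (superData c).Character)

/-- The generators of the left ideal that defines the induced module. -/
def annSet : Set (Alg c) := {a | ∃ i, i ∉ C.N ∧ a = mode c i - algebraMap ℂ _ (C.χ i)}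

lemma isHW_mk {I : Submodule (Alg c) (Alg c)} (hI : C.annSet ⊆ I) :
    C.IsHW (Submodule.Quotient.mk 1 : Alg c ⧸ I) := by
  intro i hi
  rw [← Submodule.Quotient.mk_smul, ← Submodule.Quotient.mk_smul, Submodule.Quotient.eq]
  have : mode c i - algebraMap ℂ _ (C.χ i) ∈ I := hI ⟨i, hi, rfl⟩
  simpa [Algebra.algebraMap_eq_smul_one] using this

/-- The universal property of the induced module, in terms of operators. -/
lemma exists_map_of_operators {I : Submodule (Alg c) (Alg c)}
    (hI : I = Submodule.span _ C.annSet) {P : Type*} [AddCommGroup P] [Module ℂ P]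
    (X : Gen → Module.End ℂ P)
    (hX : ∀ i j, ∀ y, X i (X j y) - (superData c).sgn i j • X j (X i y) =
      (((superData c).br i j).1.sum fun k a => a • X k y) + ((superData c).br i j).2 • y)
    (z : P) (hz : ∀ i, i ∉ C.N → X i z = C.χ i • z) :
    ∃ f : (Alg c ⧸ I) →ₗ[ℂ] P, f (Submodule.Quotient.mk 1) = z ∧
      ∀ i u, f (mode c i • u) = X i (f u) := by
  obtain ⟨ρ, hρ⟩ := exists_algHom c X (fun i j => LinearMap.ext fun y => by
    rw [ev_end_apply]
    exact hX i j y)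
  have hann : I.restrictScalars ℂ ≤ LinearMap.ker ((LinearMap.applyₗ z).comp ρ.toLinearMap) := by
    intro a ha
    rw [Submodule.restrictScalars_mem, hI] at ha
    simp only [LinearMap.mem_ker, LinearMap.comp_apply, LinearMap.applyₗ_apply_apply,
      AlgHom.toLinearMap_apply]
    induction ha using Submodule.span_induction with
    | mem x hx =>
      obtain ⟨i, hi, rfl⟩ := hx
      rw [map_sub, AlgHom.commutes, hρ, LinearMap.sub_apply, hz i hi,
        Algebra.algebraMap_eq_smul_one, LinearMap.smul_apply, Module.End.one_apply, sub_self]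
    | zero => simp
    | add x y _ _ hx hy => rw [map_add, LinearMap.add_apply, hx, hy, add_zero]
    | smul a x _ hx => rw [smul_eq_mul, map_mul, Module.End.mul_apply, hx, map_zero]
  refine ⟨(Submodule.liftQ _ _ hann).comp
    (Submodule.Quotient.restrictScalarsEquiv ℂ I).symm.toLinearMap, ?_, fun i u => ?_⟩
  · change ρ 1 z = z
    simp
  · obtain ⟨a, rfl⟩ := Submodule.Quotient.mk_surjective _ u
    change ρ (mode c i * a) z = X i (ρ a z)
    rw [map_mul, hρ, Module.End.mul_apply]

/-- The Poincaré–Birkhoff–Witt theorem for the induced module. -/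
theorem isFree_mk [LinearOrder Gen] {I : Submodule (Alg c) (Alg c)}
    (hI : I = Submodule.span _ C.annSet) :
    C.IsFree (Submodule.Quotient.mk 1 : Alg c ⧸ I) := by
  have hv := C.isHW_mk (I := I) (hI ▸ Submodule.subset_span)
  refine ⟨hv, fun y hy h0 => ?_, fun u => ?_⟩
  -- Independence: by `comm_single` the span of the standard words is a module of the required type,
  -- and the induced map takes a standard word applied to the cyclic vector to that word.
  · obtain ⟨f, hf1, hf⟩ := C.exists_map_of_operators hI (P := C.stdSub)
      (fun i => (C.T i).restrict (fun y (hy : y ∈ C.stdSub) => C.T_mem_stdSub hy)) (by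
        intro i j x
        apply Subtype.ext
        have := C.comm_of_mem_stdSub x.2 i j
        unfold Comm at this
        rw [ev_end_apply] at this
        simpa [Finsupp.sum, LinearMap.restrict_apply] using this)
      ⟨single [] 1, C.single_mem_stdSub C.std_nil⟩ (by
        intro i hi
        apply Subtype.ext
        simp [LinearMap.restrict_apply, T_single, C.act_nil_of_notMem hi])
    have hword : ∀ W, C.Std W →
        (f (word c W • Submodule.Quotient.mk 1) : List Gen →₀ ℂ) = single W 1 := by
      intro W
      induction W with
      | nil => intro _; simp [word, hf1]
      | cons i W ih =>
        intro hW
        obtain ⟨hok, hW'⟩ := C.std_cons.1 hW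
        rw [word_cons, mul_smul, hf, LinearMap.coe_restrict_apply, ih hW', T_single, C.act_ok hok]
    have := eq_of_supported (C.stdSub.subtype ∘ₗ f ∘ₗ toMod c (Submodule.Quotient.mk 1))
      LinearMap.id (fun K hK => by simpa [toMod_single] using hword K hK) hy
    simpa [h0] using this.symm
  -- Spanning: the image of the standard words is stable under all modes and contains the cyclic
  -- vector.
  · set S : Submodule ℂ (Alg c ⧸ I) := C.stdSub.map (toMod c (Submodule.Quotient.mk 1))
    have hS := smul_mem_of_mode S (by
      rintro i _ ⟨y, hy, rfl⟩
      exact ⟨C.T i y, C.T_mem_stdSub hy, C.toMod_T hv i hy⟩)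
    obtain ⟨a, rfl⟩ := Submodule.Quotient.mk_surjective _ u
    have := hS a (Submodule.Quotient.mk 1)
      ⟨single [] 1, C.single_mem_stdSub C.std_nil, by rw [toMod_single]; simp [word]⟩
    rw [← Submodule.Quotient.mk_smul, smul_eq_mul, mul_one] at this
    exact this

end SuperLie.Character

/-! ### Weight filtrations -/

open Finsupp

namespace SuperLie.Character

section Measure

variable {ι : Type*} {D : SuperLie ι} (C : D.Character)

/-- A weight function on the letters that does not increase under supercommutators and under the
character. -/
structure Compatible (μ : ι → ℤ) : Prop where
  br : ∀ i j, ∀ k ∈ (D.br i j).1.support, μ k ≤ μ i + μ j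
  sc : ∀ i j, (D.br i j).2 ≠ 0 → 0 ≤ μ i + μ j
  char : ∀ i, i ∉ C.N → C.χ i ≠ 0 → 0 ≤ μ i

variable [LinearOrder ι]

/-- The span of the standard words of weight at most `e`. -/
noncomputable def filt (μ : ι → ℤ) (e : ℤ) : Submodule ℂ (List ι →₀ ℂ) :=
  supported ℂ ℂ {K | C.Std K ∧ (K.map μ).sum ≤ e}

lemma filt_mono {μ : ι → ℤ} {e e' : ℤ} (h : e ≤ e') : C.filt μ e ≤ C.filt μ e' :=
  supported_mono fun _ hK => ⟨hK.1, hK.2.trans h⟩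

lemma single_mem_filt {μ : ι → ℤ} {e : ℤ} {K : List ι} (hK : C.Std K)
    (h : (K.map μ).sum ≤ e) : single K 1 ∈ C.filt μ e :=
  single_mem_supported _ _ ⟨hK, h⟩

variable {C}

/-- Each step of the recursion permutes letters, replaces two letters by their bracket, or evaluates
the character, and none of these raises a compatible weight. -/
lemma Compatible.act_mem {μ : ι → ℤ} (hμ : C.Compatible μ) (n : ℕ) : ∀ (i : ι) (M : List ι),
    M.length = n → C.Std M → C.act i M ∈ C.filt μ (μ i + (M.map μ).sum) := by
  induction n using Nat.strong_induction_on with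
  | _ n ih =>
  intro i M hn hM
  by_cases hok : C.ok i M
  · rw [C.act_ok hok]
    exact C.single_mem_filt (C.std_cons.2 ⟨hok, hM⟩) (by simp)
  cases M with
  | nil =>
    have hi : i ∉ C.N := fun h => hok ⟨h, by simp⟩
    rw [C.act_nil_of_notMem hi]
    by_cases h0 : C.χ i = 0
    · rw [h0, zero_smul]; exact Submodule.zero_mem _
    · exact Submodule.smul_mem _ _ (C.single_mem_filt C.std_nil (by simpa using hμ.char i hi h0))
  | cons j M =>
    simp only [List.length_cons] at hn
    obtain ⟨hj, hM'⟩ := C.std_cons.1 hM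
    by_cases hij : i = j
    · subst hij
      rw [C.act_cons_self hok]
      exact Submodule.zero_mem _
    rw [C.act_cons hM hok hij, ev_end_apply]
    simp only [List.map_cons, List.sum_cons, T_single]
    refine Submodule.add_mem _ (Submodule.smul_mem _ _ ?_) (Submodule.add_mem _ ?_ ?_)
    · have h1 : C.act i M ∈ supported ℂ ℂ
          (C.shape i M ∩ {K | C.Std K ∧ (K.map μ).sum ≤ μ i + (M.map μ).sum}) := by
        rw [mem_supported]
        exact Set.subset_inter ((mem_supported _ _).1 (C.act_mem_shape hM'))
          ((mem_supported _ _).1 (ih M.length (by omega) i M rfl hM'))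
      refine map_mem_of_supported (C.T j) _ (fun K hK => ?_) h1
      rw [T_single]
      have hKμ := hK.2.2
      rcases hK.1.2 with h | ⟨_, h⟩
      · exact C.filt_mono (by linarith) (ih K.length (by omega) j K rfl hK.2.1)
      · have hokK := C.ok_of_perm hj (Or.inl (C.not_ok_cons hM hok (by tauto) hij)) h
        rw [C.act_ok hokK]
        exact C.single_mem_filt (C.std_cons.2 ⟨hokK, hK.2.1⟩)
          (by simp only [List.map_cons, List.sum_cons]; linarith)
    · refine Submodule.sum_mem _ fun k hk => Submodule.smul_mem _ _ ?_
      exact C.filt_mono (by linarith [hμ.br i j k hk]) (ih M.length (by omega) k M rfl hM')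
    · by_cases h0 : (D.br i j).2 = 0
      · rw [h0, zero_smul]; exact Submodule.zero_mem _
      · exact Submodule.smul_mem _ _ (C.single_mem_filt hM' (by linarith [hμ.sc i j h0]))

lemma Compatible.T_mem {μ : ι → ℤ} (hμ : C.Compatible μ) (i : ι) {e : ℤ} {y : List ι →₀ ℂ}
    (hy : y ∈ C.filt μ e) : C.T i y ∈ C.filt μ (μ i + e) :=
  map_mem_of_supported (C.T i) _ (fun K hK => by
    rw [T_single]
    exact C.filt_mono (by linarith [hK.2]) (hμ.act_mem _ i K rfl hK.1)) hy

lemma mem_filt_iff {μ : ι → ℤ} {e : ℤ} {y : List ι →₀ ℂ} :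
    y ∈ C.filt μ e ↔ ∀ K ∈ y.support, C.Std K ∧ (K.map μ).sum ≤ e :=
  (mem_supported _ _).trans Iff.rfl

end Measure

end SuperLie.Character

/-! ### Massive and topological conditions as characters -/

section Concrete

open SuperLie

/-- The creation modes `L_{<0}`, `H_{<0}`, `Q_{≤q}`, `G_{≤p}`. -/
def creation (q p : ℤ) : Set Gen := fun g =>
  match g with
  | .L n => n ≤ -1
  | .H n => n ≤ -1
  | .Q n => n ≤ q
  | .G n => n ≤ p

lemma L_mem_creation {q p n : ℤ} : Gen.L n ∈ creation q p ↔ n ≤ -1 := Iff.rfl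
lemma H_mem_creation {q p n : ℤ} : Gen.H n ∈ creation q p ↔ n ≤ -1 := Iff.rfl
lemma Q_mem_creation {q p n : ℤ} : Gen.Q n ∈ creation q p ↔ n ≤ q := Iff.rfl
lemma G_mem_creation {q p n : ℤ} : Gen.G n ∈ creation q p ↔ n ≤ p := Iff.rfl

/-- The values of a highest weight on the modes. -/
def weightFun (a b : ℂ) (g : Gen) : ℂ :=
  match g with
  | .L n => a * delta n
  | .H n => b * delta n
  | .Q _ => 0
  | .G _ => 0

/-- The condition for the weight `L_0 = a`, `H_0 = b` to be consistent with `Q_{>q}` and `G_{>p}`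
being annihilation operators. -/
def WeightOK (c : ℂ) (q p : ℤ) (a b : ℂ) : Prop :=
  0 ≤ q + p + 2 ∧ (q + p + 2 = 0 →
    2 * a - 2 * ((q : ℂ) + 1) * b + c / 3 * (((p : ℂ) + 1) ^ 2 + ((p : ℂ) + 1)) = 0)

lemma linearCombination_weightFun {c : ℂ} (a b : ℂ) (i j : Gen) :
    (((superData c).br i j).1.sum fun k x => x * weightFun a b k) =
      Finsupp.linearCombination ℂ (weightFun a b) (Gen.br c i j).1 := by
  rw [Finsupp.linearCombination_apply]; rfl

/-- The highest-weight condition with weight `L_0 = a`, `H_0 = b` and annihilation operators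
`L_{>0}`, `H_{>0}`, `Q_{>q}`, `G_{>p}`. -/
noncomputable def hwChar (c : ℂ) (q p : ℤ) (a b : ℂ) (hw : WeightOK c q p a b) :
    (superData c).Character where
  N := creation q p
  χ := weightFun a b
  closed i j hi hj k hk := by
    obtain ⟨h1, h2⟩ := Gen.mem_support_br hk
    have h0 := hw.1
    cases i <;> cases j <;> cases k <;>
      simp only [Gen.ch, Gen.idx, L_mem_creation, H_mem_creation, Q_mem_creation,
        G_mem_creation] at * <;> omega
  char i j hi hj := by
    rw [linearCombination_weightFun]
    have h0 := hw.1
    cases i <;> cases j <;>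
      simp only [L_mem_creation, H_mem_creation, Q_mem_creation, G_mem_creation, superData,
        Gen.sgn, Gen.br, weightFun, map_smul, map_sub, map_neg, map_zero,
        Finsupp.linearCombination_single, smul_eq_mul] at * <;> rename_i m n
    all_goals
      by_cases hmn : m + n = 0
      · try (simp; done)
        try
          (have hm : m = 0 := by omega
           have hn : n = 0 := by omega
           subst hm hn
           simp [delta])
        -- The remaining case is the anticommutator of `G_{p+1}` and `Q_{q+1}`. It reaches `L_0` and
        -- `H_0` only if `q + p + 2 = 0`, and then the required identity is the one in `WeightOK`.
        try
          (have hq : q + p + 2 = 0 := by omega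
           have h3 := hw.2 hq
           first
           | (have hm : m = p + 1 := by omega
              have hn : n = q + 1 := by omega
              subst hm hn
              simp [delta, hmn]
              linear_combination -h3)
           | (have hm : m = q + 1 := by omega
              have hn : n = p + 1 := by omega
              subst hm hn
              simp [delta, hmn]
              linear_combination -h3))
      · simp [delta, hmn]

lemma massiveIdeal_eq (h ℓ t : ℂ) (hw : WeightOK (centralCharge t) 0 (-1) ℓ h) :
    massiveIdeal h ℓ t = Submodule.span _ (hwChar _ 0 (-1) ℓ h hw).annSet := by
  refine congrArg (Submodule.span _) (Set.ext fun a => ⟨fun ha => ?_, ?_⟩)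
  · induction ha with
    | Q n hn => exact ⟨.Q n, by simp only [hwChar, Q_mem_creation]; omega, by
        simp [hwChar, weightFun, mode_Q]⟩
    | G n hn => exact ⟨.G n, by simp only [hwChar, G_mem_creation]; omega, by
        simp [hwChar, weightFun, mode_G]⟩
    | L n hn => exact ⟨.L n, by simp only [hwChar, L_mem_creation]; omega, by
        simp [hwChar, weightFun, mode_L, delta, show n ≠ 0 by omega]⟩
    | H n hn => exact ⟨.H n, by simp only [hwChar, H_mem_creation]; omega, by
        simp [hwChar, weightFun, mode_H, delta, show n ≠ 0 by omega]⟩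
    | H_zero => exact ⟨.H 0, by simp [hwChar, H_mem_creation], by
        simp [hwChar, weightFun, mode_H, delta]⟩
    | L_zero => exact ⟨.L 0, by simp [hwChar, L_mem_creation], by
        simp [hwChar, weightFun, mode_L, delta]⟩
  · rintro ⟨i, hi, rfl⟩
    cases i with
    | L n =>
      simp only [hwChar, L_mem_creation] at hi
      rcases eq_or_ne n 0 with rfl | hn
      · simpa [hwChar, weightFun, mode_L, delta] using MassiveAnn.L_zero
      · simpa [hwChar, weightFun, mode_L, delta, hn] using MassiveAnn.L n (by omega)
    | H n =>
      simp only [hwChar, H_mem_creation] at hi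
      rcases eq_or_ne n 0 with rfl | hn
      · simpa [hwChar, weightFun, mode_H, delta] using MassiveAnn.H_zero
      · simpa [hwChar, weightFun, mode_H, delta, hn] using MassiveAnn.H n (by omega)
    | Q n =>
      simp only [hwChar, Q_mem_creation] at hi
      simpa [hwChar, weightFun, mode_Q] using MassiveAnn.Q n (by omega)
    | G n =>
      simp only [hwChar, G_mem_creation] at hi
      simpa [hwChar, weightFun, mode_G] using MassiveAnn.G n (by omega)

/-- The lowest annihilation modes `Q_{q+1}` and `G_{-q}` have indices adding up to 1, so their
anticommutator puts no relation on the weights. -/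
lemma weightOK_massive (c : ℂ) (q : ℤ) (a b : ℂ) : WeightOK c q (-q - 1) a b :=
  ⟨by omega, fun h => absurd h (by omega)⟩

/-- The eigenvalue of `H_0` on the twisted topological highest-weight vector. -/
noncomputable def topH (h t : ℂ) (θ : ℤ) : ℂ := h - centralCharge t / 3 * θ

/-- The eigenvalue of `L_0` on the twisted topological highest-weight vector. -/
noncomputable def topL (h t : ℂ) (θ : ℤ) : ℂ :=
  -(θ * topH h t θ) - centralCharge t / 6 * ((θ : ℂ) ^ 2 + θ)

lemma weightOK_top (h t : ℂ) (θ : ℤ) :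
    WeightOK (centralCharge t) (-θ - 1) (θ - 1) (topL h t θ) (topH h t θ) :=
  ⟨by omega, fun _ => by rw [topL]; push_cast; ring⟩

/-- The defining conditions do not mention `L_0`. Its eigenvalue follows because half the
anticommutator of `G_θ` and `Q_{-θ}`, which is `L_0 + θ H_0 + c/6 (θ² + θ)`, lies in the left ideal.
-/
lemma topIdeal_eq (h t : ℂ) (θ : ℤ) :
    topIdeal h t θ = Submodule.span _ (hwChar _ _ _ _ _ (weightOK_top h t θ)).annSet := by
  have hmem : ∀ {a}, TopAnn h t θ a → a ∈ topIdeal h t θ := fun ha => Submodule.subset_span ha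
  have hH : H (centralCharge t) 0 - algebraMap ℂ _ (topH h t θ) ∈ topIdeal h t θ := by
    rw [topH, map_sub, sub_sub_eq_add_sub]
    exact hmem TopAnn.H_zero
  have hL : L (centralCharge t) 0 - algebraMap ℂ _ (topL h t θ) ∈ topIdeal h t θ := by
    have hG : G (centralCharge t) θ ∈ topIdeal h t θ :=
      Submodule.subset_span (TopAnn.G θ le_rfl)
    have hQ : Q (centralCharge t) (-θ) ∈ topIdeal h t θ :=
      Submodule.subset_span (TopAnn.Q (-θ) le_rfl)
    have hc := RingQuot.mkAlgHom_rel ℂ (Rel.GQ (c := centralCharge t) θ (-θ))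
    simp only [Algebra.algebraMap_eq_smul_one] at hc
    simp only [map_add, map_mul, map_sub, map_smul, map_one, add_neg_cancel, delta, if_true] at hc
    have key : L (centralCharge t) 0 - algebraMap ℂ _ (topL h t θ) =
        algebraMap ℂ (Alg (centralCharge t)) (1 / 2) *
          (G (centralCharge t) θ * Q (centralCharge t) (-θ)
            + Q (centralCharge t) (-θ) * G (centralCharge t) θ)
        - algebraMap ℂ (Alg (centralCharge t)) θ *
          (H (centralCharge t) 0 - algebraMap ℂ _ (topH h t θ)) := by
      have hc' : G (centralCharge t) θ * Q (centralCharge t) (-θ)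
            + Q (centralCharge t) (-θ) * G (centralCharge t) θ = _ := hc
      rw [hc', topL]
      change _ = algebraMap ℂ (Alg (centralCharge t)) (1 / 2) *
        ((2 : ℂ) • L (centralCharge t) 0 - (2 * ((-θ : ℤ) : ℂ)) • H (centralCharge t) 0
          + (centralCharge t / 3 * ((θ : ℂ) ^ 2 + θ) * 1) • 1) - _
      simp only [Algebra.algebraMap_eq_smul_one, smul_mul_assoc, one_mul]
      push_cast
      module
    rw [key]
    refine Submodule.sub_mem _ (Submodule.smul_mem _ _ (Submodule.add_mem _ ?_ ?_))
      (Submodule.smul_mem _ _ hH)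
    · exact Submodule.smul_mem _ _ hQ
    · exact Submodule.smul_mem _ _ hG
  refine le_antisymm (Submodule.span_le.2 ?_) (Submodule.span_le.2 ?_)
  · intro a ha
    induction ha with
    | Q n hn => exact Submodule.subset_span ⟨.Q n, by simp only [hwChar, Q_mem_creation]; omega, by
        simp [hwChar, weightFun, mode_Q]⟩
    | G n hn => exact Submodule.subset_span ⟨.G n, by simp only [hwChar, G_mem_creation]; omega, by
        simp [hwChar, weightFun, mode_G]⟩
    | L n hn => exact Submodule.subset_span ⟨.L n, by simp only [hwChar, L_mem_creation]; omega, by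
        simp [hwChar, weightFun, mode_L, delta, show n ≠ 0 by omega]⟩
    | H n hn => exact Submodule.subset_span ⟨.H n, by simp only [hwChar, H_mem_creation]; omega, by
        simp [hwChar, weightFun, mode_H, delta, show n ≠ 0 by omega]⟩
    | H_zero => exact Submodule.subset_span ⟨.H 0, by simp [hwChar, H_mem_creation], by
        simp [hwChar, weightFun, mode_H, delta, topH, sub_sub_eq_add_sub]⟩
  · rintro _ ⟨i, hi, rfl⟩
    cases i with
    | L n =>
      simp only [hwChar, L_mem_creation] at hi
      rcases eq_or_ne n 0 with rfl | hn
      · simpa [hwChar, weightFun, mode_L, delta] using hL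
      · simpa [hwChar, weightFun, mode_L, delta, hn] using
          hmem (TopAnn.L n (by omega))
    | H n =>
      simp only [hwChar, H_mem_creation] at hi
      rcases eq_or_ne n 0 with rfl | hn
      · simpa [hwChar, weightFun, mode_H, delta] using hH
      · simpa [hwChar, weightFun, mode_H, delta, hn] using
          hmem (TopAnn.H n (by omega))
    | Q n =>
      simp only [hwChar, Q_mem_creation] at hi
      simpa [hwChar, weightFun, mode_Q] using hmem (TopAnn.Q n (by omega))
    | G n =>
      simp only [hwChar, G_mem_creation] at hi
      simpa [hwChar, weightFun, mode_G] using hmem (TopAnn.G n (by omega))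

end Concrete

/-! ### Maps out of induced modules and relations on vectors -/

open SuperLie

namespace SuperLie.Character

/-- The module induced from a character. -/
abbrev Ind {c : ℂ} (C : (superData c).Character) : Type := Alg c ⧸ Submodule.span (Alg c) C.annSet

/-- The cyclic vector of the induced module. -/
noncomputable def vec {c : ℂ} (C : (superData c).Character) : C.Ind := Submodule.Quotient.mk 1

variable {c : ℂ} {C : (superData c).Character}
  {M : Type*} [AddCommGroup M] [Module ℂ M] [Module (Alg c) M] [IsScalarTower ℂ (Alg c) M]

lemma isHW_vec : C.IsHW C.vec := C.isHW_mk Submodule.subset_span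

lemma smul_mk_one {I : Submodule (Alg c) (Alg c)} (u : Alg c ⧸ I) :
    ∃ a : Alg c, a • (Submodule.Quotient.mk 1 : Alg c ⧸ I) = u := by
  obtain ⟨a, rfl⟩ := Submodule.Quotient.mk_surjective _ u
  exact ⟨a, by rw [← Submodule.Quotient.mk_smul, smul_eq_mul, mul_one]⟩

lemma IsHW.exists_hom {I : Submodule (Alg c) (Alg c)} (hI : I = Submodule.span _ C.annSet)
    {v : M} (hv : C.IsHW v) :
    ∃ f : (Alg c ⧸ I) →ₗ[Alg c] M, f (Submodule.Quotient.mk 1) = v := by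
  have h : I ≤ LinearMap.ker (LinearMap.toSpanSingleton (Alg c) M v) := by
    rw [hI, Submodule.span_le]
    rintro _ ⟨i, hi, rfl⟩
    simp [sub_smul, hv i hi, algebraMap_smul]
  refine ⟨Submodule.liftQ I _ h, ?_⟩
  rw [Submodule.liftQ_apply]
  simp

end SuperLie.Character

section Relations

variable {c : ℂ} {M : Type*} [AddCommGroup M] [Module ℂ M] [Module (Alg c) M]
  [IsScalarTower ℂ (Alg c) M] (x : M) (m n : ℤ)

lemma G_Q_smul : mode c (.G m) • mode c (.Q n) • x + mode c (.Q n) • mode c (.G m) • x =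
    (2 : ℂ) • mode c (.L (m + n)) • x - (2 * (n : ℂ)) • mode c (.H (m + n)) • x
      + (c / 3 * ((m : ℂ) ^ 2 + m) * delta (m + n)) • x := by
  have := Character.mode_comm_smul (c := c) (.G m) (.Q n) x
  rw [← Finsupp.linearCombination_apply] at this
  simpa only [superData, Gen.sgn, Gen.br, map_sub, map_smul, map_neg, map_zero,
    Finsupp.linearCombination_single, one_smul, neg_smul, sub_neg_eq_add, zero_smul, add_zero]
    using this

lemma L_G_smul : mode c (.L m) • mode c (.G n) • x =
    mode c (.G n) • mode c (.L m) • x + ((m : ℂ) - n) • mode c (.G (m + n)) • x := by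
  have := Character.mode_comm_smul (c := c) (.L m) (.G n) x
  rw [← Finsupp.linearCombination_apply] at this
  rw [← sub_eq_iff_eq_add']
  simpa only [superData, Gen.sgn, Gen.br, map_sub, map_smul, map_neg, map_zero,
    Finsupp.linearCombination_single, one_smul, neg_smul, sub_neg_eq_add, zero_smul, add_zero]
    using this

lemma H_G_smul : mode c (.H m) • mode c (.G n) • x =
    mode c (.G n) • mode c (.H m) • x + mode c (.G (m + n)) • x := by
  have := Character.mode_comm_smul (c := c) (.H m) (.G n) x
  rw [← Finsupp.linearCombination_apply] at this
  rw [← sub_eq_iff_eq_add']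
  simpa only [superData, Gen.sgn, Gen.br, map_sub, map_smul, map_neg, map_zero,
    Finsupp.linearCombination_single, one_smul, neg_smul, sub_neg_eq_add, zero_smul, add_zero]
    using this

lemma L_Q_smul : mode c (.L m) • mode c (.Q n) • x =
    mode c (.Q n) • mode c (.L m) • x - (n : ℂ) • mode c (.Q (m + n)) • x := by
  have := Character.mode_comm_smul (c := c) (.L m) (.Q n) x
  rw [← Finsupp.linearCombination_apply] at this
  rw [sub_eq_add_neg, ← sub_eq_iff_eq_add']
  simpa only [superData, Gen.sgn, Gen.br, map_sub, map_smul, map_neg, map_zero,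
    Finsupp.linearCombination_single, one_smul, neg_smul, sub_neg_eq_add, zero_smul, add_zero]
    using this

lemma H_Q_smul : mode c (.H m) • mode c (.Q n) • x =
    mode c (.Q n) • mode c (.H m) • x - mode c (.Q (m + n)) • x := by
  have := Character.mode_comm_smul (c := c) (.H m) (.Q n) x
  rw [← Finsupp.linearCombination_apply] at this
  rw [sub_eq_add_neg, ← sub_eq_iff_eq_add']
  simpa only [superData, Gen.sgn, Gen.br, map_sub, map_smul, map_neg, map_zero,
    Finsupp.linearCombination_single, one_smul, neg_smul, sub_neg_eq_add, zero_smul, add_zero]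
    using this

lemma G_G_smul : mode c (.G m) • mode c (.G n) • x = -(mode c (.G n) • mode c (.G m) • x) := by
  have := Character.mode_comm_smul (c := c) (.G m) (.G n) x
  rw [eq_neg_iff_add_eq_zero]
  simpa only [superData, Gen.sgn, Gen.br, map_sub, map_smul, map_neg, map_zero,
    Finsupp.linearCombination_single, one_smul, neg_smul, sub_neg_eq_add, zero_smul, add_zero,
    Finsupp.sum_zero_index]
    using this

lemma Q_Q_smul : mode c (.Q m) • mode c (.Q n) • x = -(mode c (.Q n) • mode c (.Q m) • x) := by
  have := Character.mode_comm_smul (c := c) (.Q m) (.Q n) x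
  rw [eq_neg_iff_add_eq_zero]
  simpa only [superData, Gen.sgn, Gen.br, map_sub, map_smul, map_neg, map_zero,
    Finsupp.linearCombination_single, one_smul, neg_smul, sub_neg_eq_add, zero_smul, add_zero,
    Finsupp.sum_zero_index]
    using this

end Relations

/-! ### Spectral flow between twisted massive modules -/

section Flow

variable {c : ℂ} {M : Type*} [AddCommGroup M] [Module ℂ M] [Module (Alg c) M]
  [IsScalarTower ℂ (Alg c) M]

omit [IsScalarTower ℂ (Alg c) M] in
lemma isHW_hwChar_iff {q p : ℤ} {a b : ℂ} {hw : WeightOK c q p a b} {v : M} :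
    (hwChar c q p a b hw).IsHW v ↔
      (∀ n, 1 ≤ n → mode c (.L n) • v = 0) ∧ (∀ n, 1 ≤ n → mode c (.H n) • v = 0) ∧
      (∀ n, q < n → mode c (.Q n) • v = 0) ∧ (∀ n, p < n → mode c (.G n) • v = 0) ∧
      mode c (.L 0) • v = a • v ∧ mode c (.H 0) • v = b • v := by
  constructor
  · intro h
    refine ⟨fun n hn => ?_, fun n hn => ?_, fun n hn => ?_, fun n hn => ?_, ?_, ?_⟩
    · rw [h (.L n) (by simp only [hwChar, L_mem_creation]; omega)]
      simp [hwChar, weightFun, delta, show n ≠ 0 by omega]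
    · rw [h (.H n) (by simp only [hwChar, H_mem_creation]; omega)]
      simp [hwChar, weightFun, delta, show n ≠ 0 by omega]
    · rw [h (.Q n) (by simp only [hwChar, Q_mem_creation]; omega)]
      simp [hwChar, weightFun]
    · rw [h (.G n) (by simp only [hwChar, G_mem_creation]; omega)]
      simp [hwChar, weightFun]
    · rw [h (.L 0) (by simp [hwChar, L_mem_creation])]
      simp [hwChar, weightFun, delta]
    · rw [h (.H 0) (by simp [hwChar, H_mem_creation])]
      simp [hwChar, weightFun, delta]
  · rintro ⟨hL, hH, hQ, hG, hL0, hH0⟩ i hi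
    cases i with
    | L n =>
      simp only [hwChar, L_mem_creation] at hi
      rcases eq_or_ne n 0 with rfl | hn
      · simpa [hwChar, weightFun, delta] using hL0
      · simpa [hwChar, weightFun, delta, hn] using hL n (by omega)
    | H n =>
      simp only [hwChar, H_mem_creation] at hi
      rcases eq_or_ne n 0 with rfl | hn
      · simpa [hwChar, weightFun, delta] using hH0
      · simpa [hwChar, weightFun, delta, hn] using hH n (by omega)
    | Q n =>
      simp only [hwChar, Q_mem_creation] at hi
      simpa [hwChar, weightFun] using hQ n (by omega)
    | G n =>
      simp only [hwChar, G_mem_creation] at hi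
      simpa [hwChar, weightFun] using hG n (by omega)

/-- The massive highest-weight condition with twist `q`. -/
noncomputable abbrev massiveChar (c : ℂ) (q : ℤ) (a b : ℂ) : (superData c).Character :=
  hwChar c q (-q - 1) a b (weightOK_massive c q a b)

/-- The factor by which `Q_{q+1} G_{-q-1}` acts on a massive highest-weight vector. -/
noncomputable def flowFactor (c : ℂ) (q : ℤ) (a b : ℂ) : ℂ :=
  2 * a - 2 * ((q : ℂ) + 1) * b + c / 3 * ((q : ℂ) ^ 2 + q)

variable {q : ℤ} {a b : ℂ} {v : M}

/-- `G_{-q-1}` is the highest creation mode among the `G`, so it becomes an annihilation mode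
because its square is zero. In exchange `Q_{q+1}` is released: for larger indices the anticommutator
contains only `L` and `H` of positive index. -/
lemma isHW_flow_up (hv : (massiveChar c q a b).IsHW v) :
    (massiveChar c (q + 1) (a + q + 1) (b + 1)).IsHW (mode c (.G (-q - 1)) • v) := by
  rw [isHW_hwChar_iff] at hv ⊢
  obtain ⟨hL, hH, hQ, hG, hL0, hH0⟩ := hv
  refine ⟨fun n hn => ?_, fun n hn => ?_, fun n hn => ?_, fun n hn => ?_, ?_, ?_⟩
  · rw [L_G_smul, hL n hn, hG _ (by omega)]; simp
  · rw [H_G_smul, hH n hn, hG _ (by omega)]; simp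
  · have := G_Q_smul (c := c) v (-q - 1) n
    rw [hQ n (by omega), hL _ (by omega), hH _ (by omega)] at this
    simpa [delta, show -q - 1 + n ≠ 0 by omega] using this
  · rcases eq_or_ne n (-q - 1) with rfl | h
    · have : (2 : ℂ) • mode c (.G (-q - 1)) • mode c (.G (-q - 1)) • v = 0 := by
        rw [two_smul]
        nth_rewrite 1 [G_G_smul]
        simp
      exact (smul_eq_zero.1 this).resolve_left two_ne_zero
    · rw [G_G_smul, hG n (by omega)]; simp
  · rw [L_G_smul, hL0, smul_comm, zero_add, ← add_smul]
    congr 1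
    push_cast
    ring
  · rw [H_G_smul, hH0, smul_comm]
    simp [add_smul]

/-- Since `Q_{q+1}` kills `v`, the product equals the anticommutator, which involves only `L_0`,
`H_0` and a constant. -/
lemma flow_up_down (hv : (massiveChar c q a b).IsHW v) :
    mode c (.Q (q + 1)) • mode c (.G (-q - 1)) • v = flowFactor c q a b • v := by
  rw [isHW_hwChar_iff] at hv
  obtain ⟨hL, hH, hQ, hG, hL0, hH0⟩ := hv
  have := G_Q_smul (c := c) v (-q - 1) (q + 1)
  rw [hQ _ (by omega), show -q - 1 + (q + 1) = 0 by ring, hL0, hH0, smul_zero, zero_add] at this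
  rw [this, flowFactor, delta, if_pos rfl, smul_smul, smul_smul, ← sub_smul, ← add_smul]
  congr 1
  push_cast
  ring

lemma isHW_flow_down (hv : (massiveChar c q a b).IsHW v) :
    (massiveChar c (q - 1) (a - q) (b - 1)).IsHW (mode c (.Q q) • v) := by
  rw [isHW_hwChar_iff] at hv ⊢
  obtain ⟨hL, hH, hQ, hG, hL0, hH0⟩ := hv
  refine ⟨fun n hn => ?_, fun n hn => ?_, fun n hn => ?_, fun n hn => ?_, ?_, ?_⟩
  · rw [L_Q_smul, hL n hn, hQ _ (by omega)]; simp
  · rw [H_Q_smul, hH n hn, hQ _ (by omega)]; simp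
  · rcases eq_or_ne n q with rfl | h
    · have : (2 : ℂ) • mode c (.Q n) • mode c (.Q n) • v = 0 := by
        rw [two_smul]
        nth_rewrite 1 [Q_Q_smul]
        simp
      exact (smul_eq_zero.1 this).resolve_left two_ne_zero
    · rw [Q_Q_smul, hQ n (by omega)]; simp
  · have := G_Q_smul (c := c) v n q
    rw [hG n (by omega), hL _ (by omega), hH _ (by omega)] at this
    simpa [delta, show n + q ≠ 0 by omega] using this
  · rw [L_Q_smul, hL0, smul_comm]
    simp [sub_smul]
  · rw [H_Q_smul, hH0, smul_comm]
    simp [sub_smul]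

lemma flow_down_up (hv : (massiveChar c q a b).IsHW v) :
    mode c (.G (-q)) • mode c (.Q q) • v = flowFactor c (q - 1) (a - q) (b - 1) • v := by
  rw [isHW_hwChar_iff] at hv
  obtain ⟨hL, hH, hQ, hG, hL0, hH0⟩ := hv
  have := G_Q_smul (c := c) v (-q) q
  rw [hG _ (by omega), show -q + q = 0 by ring, hL0, hH0, smul_zero, add_zero] at this
  rw [this, flowFactor, delta, if_pos rfl, smul_smul, smul_smul, ← sub_smul, ← add_smul]
  congr 1
  push_cast
  ring

/-- The spectral flow isomorphism between twisted massive modules. -/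
lemma nonempty_flow_equiv {a' b' : ℂ} (ha : a' = a + q + 1) (hb : b' = b + 1)
    (hD : flowFactor c q a b ≠ 0) :
    Nonempty ((massiveChar c q a b).Ind ≃ₗ[Alg c] (massiveChar c (q + 1) a' b').Ind) := by
  subst ha hb
  set C := massiveChar c q a b
  set C' := massiveChar c (q + 1) (a + q + 1) (b + 1)
  have hv : C.IsHW C.vec := Character.isHW_vec
  have hv' : C'.IsHW C'.vec := Character.isHW_vec
  obtain ⟨g, hg⟩ := (isHW_flow_up hv).exists_hom (I := Submodule.span _ C'.annSet) rfl
  have hd := isHW_flow_down hv'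
  have hD' := flow_down_up hv'
  have e : flowFactor c (q + 1 - 1) (a + q + 1 - ((q + 1 : ℤ) : ℂ)) (b + 1 - 1) =
      flowFactor c q a b := by
    simp [flowFactor, add_assoc]
  rw [e] at hD'
  -- Dividing by the flow factor makes the two maps inverse to each other.
  have hw : C.IsHW ((flowFactor c q a b)⁻¹ • mode c (.Q (q + 1)) • C'.vec) := by
    intro i hi
    have h1 : (massiveChar c q a b).IsHW (mode c (.Q (q + 1)) • C'.vec) := by
      convert hd using 2 <;> simp [add_assoc]
    rw [smul_comm, h1 i hi, smul_comm]
  obtain ⟨f, hf⟩ := hw.exists_hom (I := Submodule.span _ C.annSet) rfl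
  refine ⟨LinearEquiv.ofLinearMap f g ?_ ?_⟩
  · refine LinearMap.ext fun u => ?_
    obtain ⟨x, rfl⟩ := Character.smul_mk_one u
    rw [map_smul, LinearMap.id_apply, LinearMap.comp_apply, hg, map_smul]
    change x • mode c _ • f (Submodule.Quotient.mk 1) = _
    rw [hf, smul_comm _ (flowFactor c q a b)⁻¹, show -q - 1 = -(q + 1) by ring, hD', smul_smul,
      inv_mul_cancel₀ hD, one_smul]
    rfl
  · refine LinearMap.ext fun u => ?_
    obtain ⟨x, rfl⟩ := Character.smul_mk_one u
    rw [map_smul, LinearMap.id_apply, LinearMap.comp_apply, hf,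
      LinearMap.map_smul_of_tower, map_smul]
    change x • _ • mode c _ • g (Submodule.Quotient.mk 1) = _
    rw [hg, flow_up_down hv, smul_smul, inv_mul_cancel₀ hD, one_smul]
    rfl

/-- The origin of the charged condition: `ℓ + q (q + 1) / 2` and `h + q` are the weights at twist
`q` on the chain through `|h,ℓ,t⟩`, so the link from `q` to `q + 1` breaks exactly at the charged
value with `r = q + 1`. -/
lemma flowFactor_eq {h ℓ t : ℂ} (ht : t ≠ 0) (q : ℤ) :
    flowFactor (centralCharge t) q (ℓ + q * (q + 1) / 2) (h + q) = 2 * (ℓ - lch (q + 1) h t) := by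
  rw [flowFactor, centralCharge, lch]
  push_cast
  field_simp
  ring

/-- Without charged singular vectors, the massive Verma module is a twisted massive Verma module
for every twist. -/
lemma nonempty_flow {h ℓ t : ℂ} (ht : t ≠ 0) (hno : ∀ r : ℤ, ℓ ≠ lch r h t) (q : ℤ) :
    Nonempty ((massiveChar (centralCharge t) 0 ℓ h).Ind ≃ₗ[Alg (centralCharge t)]
      (massiveChar (centralCharge t) q (ℓ + q * (q + 1) / 2) (h + q)).Ind) := by
  have step : ∀ q : ℤ, Nonempty
      ((massiveChar (centralCharge t) q (ℓ + q * (q + 1) / 2) (h + q)).Ind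
        ≃ₗ[Alg (centralCharge t)] (massiveChar (centralCharge t) (q + 1)
          (ℓ + ((q + 1 : ℤ) : ℂ) * (((q + 1 : ℤ) : ℂ) + 1) / 2) (h + ((q + 1 : ℤ) : ℂ))).Ind) := by
    intro q
    refine nonempty_flow_equiv ?_ ?_ ?_
    · push_cast; ring
    · push_cast; ring
    · rw [flowFactor_eq ht]
      exact mul_ne_zero two_ne_zero (sub_ne_zero.2 (hno _))
  induction q using Int.induction_on with
  | zero => 
    have e1 : ℓ + ((0 : ℤ) : ℂ) * (((0 : ℤ) : ℂ) + 1) / 2 = ℓ := by simp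
    have e2 : h + ((0 : ℤ) : ℂ) = h := by simp
    rw [e1, e2]
    exact ⟨LinearEquiv.refl _ _⟩
  | succ q ih => 
    obtain ⟨e⟩ := ih
    obtain ⟨e'⟩ := step q
    exact ⟨e.trans e'⟩
  | pred q ih => 
    obtain ⟨e⟩ := ih
    obtain ⟨e'⟩ := step (-q - 1)
    rw [sub_add_cancel] at e'
    exact ⟨e.trans e'.symm⟩

end Flow

/-! ### Kernels of anticommuting creation modes -/

open SuperLie Finsupp

/-- The position of the type of a mode. -/
def Gen.tag : Gen → ℕ
  | .L _ => 0
  | .H _ => 1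
  | .Q _ => 2
  | .G _ => 3

/-- The linear order on the modes given by a rank, then the type, then the index. -/
@[reducible]
noncomputable def rankOrder (ρ : Gen → ℕ) : LinearOrder Gen :=
  LinearOrder.lift' (fun g => toLex (ρ g, toLex (g.tag, g.idx))) (by
    intro g g' h
    have h := congrArg Prod.snd (congrArg (ofLex ∘ Prod.snd ∘ ofLex) h : _ = _)
    have h' := congrArg Prod.fst (congrArg (ofLex ∘ Prod.snd ∘ ofLex) ‹_› : _ = _)
    cases g <;> cases g' <;> simp_all [Gen.tag, Gen.idx])

lemma rankOrder_lt {ρ : Gen → ℕ} {i j : Gen} (h : ρ i < ρ j) : (rankOrder ρ).lt i j :=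
  Prod.Lex.toLex_lt_toLex.2 (Or.inl h)

lemma rank_le_of_lt {ρ : Gen → ℕ} {i j : Gen} (h : (rankOrder ρ).lt i j) : ρ i ≤ ρ j := by
  rcases Prod.Lex.toLex_lt_toLex.1 (show toLex _ < toLex _ from h) with h | h
  · exact le_of_lt h
  · exact le_of_eq h.1

namespace SuperLie.Character

variable {c : ℂ} {C : (superData c).Character} [LinearOrder Gen]

/-- An odd creation mode that anticommutes with all smaller ones, which are odd as well. -/
structure Front (C : (superData c).Character) (k : Gen) : Prop where
  mem : k ∈ C.N
  odd : (superData c).odd k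
  lt : ∀ j, j < k → (superData c).br k j = 0

lemma nodup_of_odd {W : List Gen} (hW : C.Std W) {k : Gen} (hk : (superData c).odd k) :
    k ∉ W.erase k := by
  induction W with
  | nil => simp
  | cons j W ih =>
    obtain ⟨hj, hW'⟩ := C.std_cons.1 hW
    by_cases hjk : j = k
    · subst hjk
      rw [List.erase_cons_head]
      intro h
      rcases hj.2 j h with h | h
      · exact lt_irrefl _ h
      · exact h.2 hk
    · rw [List.erase_cons_tail (by simpa using hjk), List.mem_cons, not_or]
      exact ⟨fun h => hjk h.symm, ih hW'⟩

lemma std_erase {W : List Gen} (hW : C.Std W) (k : Gen) : C.Std (W.erase k) :=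
  ⟨hW.1.sublist List.erase_sublist, fun i hi => hW.2 i (List.mem_of_mem_erase hi)⟩

lemma Front.act_of_mem {k : Gen} (hk : C.Front k) {W : List Gen} (hW : C.Std W) (hkW : k ∈ W) :
    C.act k W = 0 := by
  induction W with
  | nil => simp at hkW
  | cons j W ih =>
    obtain ⟨hj, hW'⟩ := C.std_cons.1 hW
    have hnok : ¬ C.ok k (j :: W) := by
      intro h
      rcases h.2 k hkW with h | h
      · exact lt_irrefl _ h
      · exact h.2 hk.odd
    by_cases hkj : k = j
    · subst hkj
      exact C.act_cons_self hnok
    · rw [C.act_cons hW hnok hkj, hk.lt j (C.not_ok_cons hW hnok hk.mem hkj),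
        ih hW' ((List.mem_cons.1 hkW).resolve_left hkj)]
      simp

/-- The bracket of `k` with each smaller letter vanishes, so `k` moves to its place in the word by
signs alone. -/
lemma Front.act_of_notMem {k : Gen} (hk : C.Front k) {W : List Gen} (hW : C.Std W) (hkW : k ∉ W) :
    ∃ s : ℂ, s ≠ 0 ∧ C.act k W = s • single (W.orderedInsert (· ≤ ·) k) 1 := by
  induction W with
  | nil => exact ⟨1, one_ne_zero, by rw [C.act_ok ⟨hk.mem, by simp⟩]; simp⟩
  | cons j W ih =>
    obtain ⟨hj, hW'⟩ := C.std_cons.1 hW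
    rw [List.mem_cons, not_or] at hkW
    by_cases hok : C.ok k (j :: W)
    · refine ⟨1, one_ne_zero, ?_⟩
      have hkj : k ≤ j := by
        rcases hok.2 j (by simp) with h | h
        · exact h.le
        · exact h.1.le
      rw [C.act_ok hok, List.orderedInsert, if_pos hkj, one_smul]
    · have hjk := C.not_ok_cons hW hok hk.mem hkW.1
      obtain ⟨s, hs, h⟩ := ih hW' hkW.2
      refine ⟨(superData c).sgn k j * s, mul_ne_zero ?_ hs, ?_⟩
      · intro h0
        have := (superData c).sgn_mul_self k j
        simp [h0] at this
      · have hokj : C.ok j (W.orderedInsert (· ≤ ·) k) := by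
          refine ⟨hj.1, fun l hl => ?_⟩
          rcases (List.mem_orderedInsert _).1 hl with rfl | hl
          · exact Or.inl hjk
          · exact hj.2 l hl
        rw [C.act_cons hW hok hkW.1, hk.lt j hjk, h, map_smul, T_single, C.act_ok hokj, smul_smul,
          List.orderedInsert, if_neg (not_le.2 hjk)]
        simp

variable {M : Type*} [AddCommGroup M] [Module ℂ M] [Module (Alg c) M] [IsScalarTower ℂ (Alg c) M]
  {v : M}

/-- Erasing `k` undoes its insertion, so words without `k` have distinct images, which cannot
cancel. -/
lemma Front.mem_of_T_eq_zero {k : Gen} (hk : C.Front k) {y : List Gen →₀ ℂ}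
    (hy : y ∈ C.stdSub) (h0 : C.T k y = 0) : ∀ W ∈ y.support, k ∈ W := by
  intro W hW
  by_contra hkW
  have hstd : ∀ W ∈ y.support, C.Std W := fun W h => (mem_supported _ _).1 hy h
  obtain ⟨s, hs, h⟩ := hk.act_of_notMem (hstd W hW) hkW
  have h1 := DFunLike.congr_fun h0 (W.orderedInsert (· ≤ ·) k)
  rw [T, Finsupp.linearCombination_apply, Finsupp.sum, Finsupp.finsetSum_apply,
    Finset.sum_eq_single W] at h1
  · rw [h] at h1
    simp [hs] at h1
    exact (Finsupp.mem_support_iff.1 hW) h1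
  · intro W' hW' hne
    by_cases hkW' : k ∈ W'
    · rw [hk.act_of_mem (hstd W' hW') hkW']; simp
    · obtain ⟨s', hs', h'⟩ := hk.act_of_notMem (hstd W' hW') hkW'
      rw [h', Finsupp.smul_apply, Finsupp.smul_apply, Finsupp.single_eq_of_ne]
      · simp
      · intro he
        apply hne
        rw [← List.erase_orderedInsert_of_notMem (r := (· ≤ ·)) hkW',
          ← List.erase_orderedInsert_of_notMem (r := (· ≤ ·)) hkW, he]
  · intro h; exact absurd hW h

/-- A standard word containing `k` is a nonzero multiple of `k` acting on the word with `k` erased;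
the remaining letters are extracted from that shorter word. -/
lemma IsFree.single_mem_range (hv : C.IsFree v) (Ks : List Gen) : ∀ W : List Gen, C.Std W →
    (∀ k ∈ Ks, C.Front k) → (∀ k ∈ Ks, k ∈ W) → Ks.Nodup →
    ∃ u : M, toMod c v (single W 1) = word c Ks • u := by
  induction Ks with
  | nil => intro W _ _ _ _; exact ⟨toMod c v (single W 1), by simp [word]⟩
  | cons k Ks ih =>
    intro W hW hF hmem hnd
    have hk := hF k (by simp)
    have hkW := hmem k (by simp)
    obtain ⟨s, hs, h⟩ := hk.act_of_notMem (std_erase hW k) (nodup_of_odd hW hk.odd)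
    have hle : W.Pairwise (· ≤ ·) := hW.1.imp fun h => by
      rcases h with h | h
      · exact h.le
      · exact h.1.le
    rw [List.orderedInsert_erase k W hkW hle] at h
    obtain ⟨u, hu⟩ := ih (W.erase k) (std_erase hW k) (fun l hl => hF l (by simp [hl]))
      (fun l hl => (List.mem_erase_of_ne (by
        rintro rfl
        exact (List.nodup_cons.1 hnd).1 hl)).2 (hmem l (by simp [hl]))) (List.nodup_cons.1 hnd).2
    refine ⟨s⁻¹ • u, ?_⟩
    have h2 : single W 1 = s⁻¹ • C.T k (single (W.erase k) 1) := by
      rw [T_single, h, smul_smul, inv_mul_cancel₀ hs, one_smul]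
    rw [h2, map_smul, C.toMod_T hv.hw k (C.single_mem_stdSub (std_erase hW k)), hu, word_cons,
      mul_smul, smul_comm s⁻¹, smul_comm s⁻¹]

/-- A vector killed by anticommuting creation operators lies in the image of their product. -/
lemma IsFree.exists_eq_word_smul (hv : C.IsFree v) {Ks : List Gen} (hF : ∀ k ∈ Ks, C.Front k)
    (hnd : Ks.Nodup) {x : M} (hx : ∀ k ∈ Ks, mode c k • x = 0) : ∃ u : M, x = word c Ks • u := by
  obtain ⟨y, hy, rfl⟩ := hv.surj x
  have hmem : ∀ k ∈ Ks, ∀ W ∈ y.support, k ∈ W := by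
    intro k hk
    refine (hF k hk).mem_of_T_eq_zero hy (hv.inj _ (C.T_mem_stdSub hy) ?_)
    rw [C.toMod_T hv.hw k hy, hx k hk]
  have := map_mem_of_supported (toMod c v) (s := {W | C.Std W ∧ ∀ k ∈ Ks, k ∈ W})
    (LinearMap.range (Module.toModuleEnd ℂ (S := Alg c) M (word c Ks))) (fun W hW => by
      obtain ⟨u, hu⟩ := hv.single_mem_range Ks W hW.1 hF hW.2 hnd
      exact ⟨u, hu.symm⟩) (y := y) ((mem_supported _ _).2 fun W hW =>
        ⟨(mem_supported _ _).1 hy hW, fun k hk => hmem k hk W hW⟩)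
  obtain ⟨u, hu⟩ := this
  exact ⟨u, hu.symm⟩

/-- Odd letters occur at most once in a standard word, so each element of `S` contributes positively
at most once. -/
lemma sum_le_sum_of_std {W : List Gen} (hW : C.Std W) (f : Gen → ℤ) (S : Finset Gen)
    (hS : ∀ g ∈ W, 0 < f g → (superData c).odd g ∧ g ∈ S) (hf : ∀ g ∈ S, 0 ≤ f g) :
    (W.map f).sum ≤ ∑ g ∈ S, f g := by
  induction W generalizing S with
  | nil => simpa using Finset.sum_nonneg hf
  | cons j W ih =>
    obtain ⟨hj, hW'⟩ := C.std_cons.1 hW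
    rw [List.map_cons, List.sum_cons]
    rcases le_or_gt (f j) 0 with h0 | h0
    · linarith [ih hW' S (fun g hg => hS g (by simp [hg])) hf]
    · obtain ⟨ho, hjS⟩ := hS j (by simp) h0
      rw [← Finset.add_sum_erase S f hjS]
      refine add_le_add_right (ih hW' (S.erase j) (fun g hg h => ?_)
        (fun g hg => hf g (Finset.mem_of_mem_erase hg))) _
      obtain ⟨h1, h2⟩ := hS g (by simp [hg]) h
      refine ⟨h1, Finset.mem_erase.2 ⟨?_, h2⟩⟩
      rintro rfl
      rcases hj.2 g hg with h | h
      · exact lt_irrefl _ h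
      · exact h.2 ho

lemma word_smul_toMod (hv : C.IsHW v) {μ : Gen → ℤ} (hμ : C.Compatible μ) (X : List Gen) :
    ∀ {e : ℤ} {y : List Gen →₀ ℂ}, y ∈ C.filt μ e →
      ∃ y' ∈ C.filt μ ((X.map μ).sum + e), word c X • toMod c v y = toMod c v y' := by
  induction X with
  | nil => intro e y hy; exact ⟨y, by simpa using hy, by simp [word]⟩
  | cons i X ih =>
    intro e y hy
    obtain ⟨y', hy', h⟩ := ih hy
    have hstd : y' ∈ C.stdSub := supported_mono (fun _ h => h.1) hy'
    refine ⟨C.T i y', ?_, ?_⟩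
    · rw [List.map_cons, List.sum_cons, add_assoc]
      exact hμ.T_mem i hy'
    · rw [word_cons, mul_smul, h, C.toMod_T hv i hstd]

end SuperLie.Character

/-! ### Level and charge bounds; absence of singular vectors -/

open SuperLie.Character

/-- The weight functions `level` plus a multiple of the charge. -/
def slope (s : ℤ) (g : Gen) : ℤ := g.idx + s * g.ch

lemma compatible_slope {c : ℂ} {q p : ℤ} {a b : ℂ} (hw : WeightOK c q p a b) (s : ℤ) :
    (hwChar c q p a b hw).Compatible (slope s) where
  br i j k hk := by
    obtain ⟨h1, h2⟩ := Gen.mem_support_br hk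
    rw [slope, slope, slope, h1, h2]
    linarith
  sc i j h := by
    obtain ⟨h1, h2⟩ := Gen.br_snd_ne_zero h
    have : slope s i + slope s j = (i.idx + j.idx) + s * (i.ch + j.ch) := by
      rw [slope, slope]; ring
    rw [this, h1, h2]; simp
  char i hi h := by
    cases i <;> simp_all [hwChar, weightFun, delta, slope, Gen.idx, Gen.ch]

lemma sum_range_two_mul (n : ℕ) : 2 * ∑ i ∈ Finset.range n, (i : ℤ) = n * (n - 1) := by
  induction n with
  | zero => simp
  | succ n ih => rw [Finset.sum_range_succ, mul_add, ih]; push_cast; ring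

/-- The only creation modes of positive slope are `G_{1-s}, …, G_{-1}` for `s ≥ 0` and `Q_{s+1}, …,
Q_0` for `s < 0`; taken once each, their slopes add up to `s (s - 1) / 2`. With `s` equal to the
charge `q` of the word, the bound says that its indices sum to at most `-q (q + 1) / 2`. -/
lemma slope_le [LinearOrder Gen] {c : ℂ} {a b : ℂ} {W : List Gen} (hW : (massiveChar c 0 a b).Std W)
    (s : ℤ) : 2 * (W.map (slope s)).sum ≤ s * (s - 1) := by
  rcases le_or_gt 0 s with hs | hs
  · obtain ⟨n, rfl⟩ := Int.eq_ofNat_of_zero_le hs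
    have hinj : Set.InjOn (fun i : ℕ => Gen.G ((i : ℤ) - n)) (Finset.range n) := by
      intro i _ j _ h
      simpa using h
    have h := sum_le_sum_of_std hW (slope n)
      ((Finset.range n).image fun i : ℕ => Gen.G ((i : ℤ) - n)) (fun g hg h => by
        have hN := hW.2 g hg
        cases g with
        | L m =>
          have := L_mem_creation.1 hN
          simp only [slope, Gen.idx, Gen.ch] at h
          omega
        | H m =>
          have := H_mem_creation.1 hN
          simp only [slope, Gen.idx, Gen.ch] at h
          omega
        | Q m =>
          have := Q_mem_creation.1 hN
          simp only [slope, Gen.idx, Gen.ch] at h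
          omega
        | G m =>
          have := G_mem_creation.1 hN
          simp only [slope, Gen.idx, Gen.ch] at h
          refine ⟨trivial, Finset.mem_image.2 ⟨(m + n).toNat, Finset.mem_range.2 (by omega), ?_⟩⟩
          congr 1
          omega) (fun g hg => by
        obtain ⟨i, hi, rfl⟩ := Finset.mem_image.1 hg
        simp [slope, Gen.idx, Gen.ch])
    rw [Finset.sum_image hinj] at h
    have e : ∀ i : ℕ, slope n (Gen.G ((i : ℤ) - n)) = i := fun i => by
      simp [slope, Gen.idx, Gen.ch]
    simp only [e] at h
    have := sum_range_two_mul n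
    linarith
  · obtain ⟨n, rfl⟩ := Int.exists_eq_neg_ofNat hs.le
    have hinj : Set.InjOn (fun i : ℕ => Gen.Q ((i : ℤ) - n)) (Finset.range (n + 1)) := by
      intro i _ j _ h
      simpa using h
    have h := sum_le_sum_of_std hW (slope (-n))
      ((Finset.range (n + 1)).image fun i : ℕ => Gen.Q ((i : ℤ) - n)) (fun g hg h => by
        have hN := hW.2 g hg
        cases g with
        | L m =>
          have := L_mem_creation.1 hN
          simp only [slope, Gen.idx, Gen.ch] at h
          omega
        | H m =>
          have := H_mem_creation.1 hN
          simp only [slope, Gen.idx, Gen.ch] at h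
          omega
        | G m =>
          have := G_mem_creation.1 hN
          simp only [slope, Gen.idx, Gen.ch] at h
          omega
        | Q m =>
          have := Q_mem_creation.1 hN
          simp only [slope, Gen.idx, Gen.ch] at h
          refine ⟨trivial, Finset.mem_image.2 ⟨(m + n).toNat, Finset.mem_range.2 (by omega), ?_⟩⟩
          congr 1
          omega) (fun g hg => by
        obtain ⟨i, hi, rfl⟩ := Finset.mem_image.1 hg
        simp [slope, Gen.idx, Gen.ch])
    rw [Finset.sum_image hinj] at h
    have e : ∀ i : ℕ, slope (-n) (Gen.Q ((i : ℤ) - n)) = i := fun i => by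
      simp [slope, Gen.idx, Gen.ch]
    simp only [e] at h
    have := sum_range_two_mul (n + 1)
    push_cast at this
    linarith

/-- The words of consecutive modes `Q_a, …, Q_{a+k-1}`. -/
def Qword (a : ℤ) (k : ℕ) : List Gen := (List.range k).map fun i : ℕ => Gen.Q (a + i)

/-- The words of consecutive modes `G_a, …, G_{a+k-1}`. -/
def Gword (a : ℤ) (k : ℕ) : List Gen := (List.range k).map fun i : ℕ => Gen.G (a + i)

lemma sum_slope_Qword (a s : ℤ) (k : ℕ) :
    2 * ((Qword a k).map (slope s)).sum = 2 * k * (a - s) + k * (k - 1) := by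
  rw [Qword, List.map_map]
  induction k with
  | zero => simp
  | succ k ih =>
    rw [List.range_succ, List.map_append, List.sum_append, mul_add, ih]
    simp [slope, Gen.idx, Gen.ch]
    ring

lemma sum_slope_Gword (a s : ℤ) (k : ℕ) :
    2 * ((Gword a k).map (slope s)).sum = 2 * k * (a + s) + k * (k - 1) := by
  rw [Gword, List.map_map]
  induction k with
  | zero => simp
  | succ k ih =>
    rw [List.range_succ, List.map_append, List.sum_append, mul_add, ih]
    simp [slope, Gen.idx, Gen.ch]
    ring

lemma exists_eq_Qword_smul {c : ℂ} {a b : ℂ} {q m : ℤ} {k : ℕ} (hm : m + k ≤ q + 1)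
    {x : (massiveChar c q a b).Ind} (hx : ∀ n, m ≤ n → mode c (.Q n) • x = 0) :
    ∃ u, x = word c (Qword m k) • u := by
  -- With the `Q` modes first, every letter smaller than a `Q` mode is again a `Q` mode, as `Front`
  -- requires.
  let _ := rankOrder (fun g => match g with | .Q _ => 0 | _ => 1)
  refine ((massiveChar c q a b).isFree_mk rfl).exists_eq_word_smul (fun g hg => ?_) ?_
    (fun g hg => ?_)
  · obtain ⟨i, hi, rfl⟩ := List.mem_map.1 hg
    rw [List.mem_range] at hi
    refine ⟨Q_mem_creation.2 (by omega), trivial, fun j hj => ?_⟩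
    have := rank_le_of_lt hj
    cases j <;> simp at this
    rfl
  · exact List.Nodup.map (fun i j h => by simpa using h) List.nodup_range
  · obtain ⟨i, hi, rfl⟩ := List.mem_map.1 hg
    exact hx _ (by omega)

lemma exists_eq_Gword_smul {c : ℂ} {a b : ℂ} {q m : ℤ} {k : ℕ} (hm : m + k ≤ -q)
    {x : (massiveChar c q a b).Ind} (hx : ∀ n, m ≤ n → mode c (.G n) • x = 0) :
    ∃ u, x = word c (Gword m k) • u := by
  let _ := rankOrder (fun g => match g with | .G _ => 0 | _ => 1)
  refine ((massiveChar c q a b).isFree_mk rfl).exists_eq_word_smul (fun g hg => ?_) ?_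
    (fun g hg => ?_)
  · obtain ⟨i, hi, rfl⟩ := List.mem_map.1 hg
    rw [List.mem_range] at hi
    refine ⟨G_mem_creation.2 (by omega), trivial, fun j hj => ?_⟩
    have := rank_le_of_lt hj
    cases j <;> simp at this
    rfl
  · exact List.Nodup.map (fun i j h => by simpa using h) List.nodup_range
  · obtain ⟨i, hi, rfl⟩ := List.mem_map.1 hg
    exact hx _ (by omega)

/-- The weights that occur in the image of a word. -/
lemma slope_le_of_eq_word_smul [LinearOrder Gen] {c a b : ℂ} {y : List Gen →₀ ℂ}
    (hy : y ∈ (massiveChar c 0 a b).stdSub) {X : List Gen} {u : (massiveChar c 0 a b).Ind}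
    (h : toMod c (massiveChar c 0 a b).vec y = word c X • u) {W : List Gen} (hW : W ∈ y.support)
    (s : ℤ) : 2 * (W.map (slope s)).sum ≤ 2 * (X.map (slope s)).sum + s * (s - 1) := by
  have hfree : (massiveChar c 0 a b).IsFree (massiveChar c 0 a b).vec :=
    (massiveChar c 0 a b).isFree_mk rfl
  obtain ⟨z, hz, rfl⟩ := hfree.surj u
  have hz' : z ∈ (massiveChar c 0 a b).filt (slope s) (s * (s - 1) / 2) :=
    mem_filt_iff.2 fun K hK => by
      have hK' := (mem_supported _ _).1 hz hK
      exact ⟨hK', by have := slope_le hK' s; omega⟩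
  obtain ⟨y', hy', h'⟩ := word_smul_toMod hfree.hw (compatible_slope _ s) X hz'
  have hyy : y = y' := by
    rw [← sub_eq_zero]
    refine hfree.inj _ (Submodule.sub_mem _ hy (supported_mono (fun _ h => h.1) hy')) ?_
    rw [map_sub, h, h', sub_self]
  subst hyy
  have := (mem_filt_iff.1 hy' W hW).2
  omega

lemma sum_slope (W : List Gen) (s : ℤ) :
    (W.map (slope s)).sum = (W.map Gen.idx).sum + s * (W.map Gen.ch).sum := by
  induction W with
  | nil => simp
  | cons g W ih => simp only [List.map_cons, List.sum_cons, ih, slope]; ring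

/-- Without charged singular vectors, no nonzero vector of the massive Verma module is killed by
all `Q_{≥-θ}` and `G_{≥θ}`. -/
theorem eq_zero_of_annihilated {h ℓ t : ℂ} (ht : t ≠ 0) (hno : ∀ r : ℤ, ℓ ≠ lch r h t) (θ : ℤ)
    {x : (massiveChar (centralCharge t) 0 ℓ h).Ind}
    (hQ : ∀ n, -θ ≤ n → mode (centralCharge t) (.Q n) • x = 0)
    (hG : ∀ n, θ ≤ n → mode (centralCharge t) (.G n) • x = 0) : x = 0 := by
  let _ := rankOrder (fun _ => 0)
  have hfree : (massiveChar (centralCharge t) 0 ℓ h).IsFree (massiveChar (centralCharge t) 0 ℓ h).vec :=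
    (massiveChar (centralCharge t) 0 ℓ h).isFree_mk rfl
  obtain ⟨y, hy, rfl⟩ := hfree.surj x
  by_contra hne
  have hy0 : y ≠ 0 := fun h => hne (by simp [h])
  obtain ⟨W, hW⟩ := Finsupp.support_nonempty_iff.2 hy0
  set q := (W.map Gen.ch).sum with hq
  set N := (W.map Gen.idx).sum with hN
  -- Large enough to contradict `2 N + q ^ 2 + q ≤ -2 k`, to which both cases lead.
  set k : ℕ := (2 * N + q ^ 2 + q).natAbs + 1 with hk
  have hk' : -(2 * N + q ^ 2 + q) < (k : ℤ) := by omega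
  rcases le_or_gt (-θ) q with hc | hc
  -- At this twist `Q_{-θ}, …, Q_{-θ+k-1}` are creation modes. They kill the vector, so it factors
  -- through their product.
  · obtain ⟨e⟩ := nonempty_flow ht hno (-θ + k)
    obtain ⟨u, hu⟩ := exists_eq_Qword_smul (m := -θ) (k := k) (by omega)
      (x := e (toMod (centralCharge t) (massiveChar (centralCharge t) 0 ℓ h).vec y)) (fun n hn => by
        rw [← map_smul, hQ n hn, map_zero])
    have hu' : toMod (centralCharge t) (massiveChar (centralCharge t) 0 ℓ h).vec y = word (centralCharge t) (Qword (-θ) k) • e.symm u := by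
      rw [← map_smul, ← hu, LinearEquiv.symm_apply_apply]
    -- The slope is the charge left after removing `k` modes of charge -1. The bound becomes `2 N +
    -- q ^ 2 + q ≤ -2 k (q + θ + 1)`.
    have := slope_le_of_eq_word_smul hy hu' hW (q + k)
    rw [sum_slope_Qword, sum_slope, ← hq, ← hN] at this
    nlinarith [mul_nonneg (Int.natCast_nonneg k) (sub_nonneg.2 hc)]
  · obtain ⟨e⟩ := nonempty_flow ht hno (-θ - k)
    obtain ⟨u, hu⟩ := exists_eq_Gword_smul (m := θ) (k := k) (by omega)
      (x := e (toMod (centralCharge t) (massiveChar (centralCharge t) 0 ℓ h).vec y)) (fun n hn => by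
        rw [← map_smul, hG n hn, map_zero])
    have hu' : toMod (centralCharge t) (massiveChar (centralCharge t) 0 ℓ h).vec y = word (centralCharge t) (Gword θ k) • e.symm u := by
      rw [← map_smul, ← hu, LinearEquiv.symm_apply_apply]
    -- Now `k` modes of charge 1 are removed, and the bound becomes `2 N + q ^ 2 + q ≤ 2 k (q + θ)`
    -- with `q + θ ≤ -1`.
    have := slope_le_of_eq_word_smul hy hu' hW (q - k)
    rw [sum_slope_Gword, sum_slope, ← hq, ← hN] at this
    nlinarith [mul_nonneg (Int.natCast_nonneg k) (show 0 ≤ -θ - q - 1 by omega)]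

/-! ### The degree filtration and contraction of partners -/

open SuperLie Finsupp

/-- The degree for which the only supercommutators of top degree are `{G_m, Q_{-1-m}}`. -/
def Gen.deg : Gen → ℤ
  | .L n => if n = -1 then 4 else 3
  | .H _ => 3
  | .Q _ => 2
  | .G _ => 2

/-- The partner of an odd mode. -/
def Gen.partner : Gen → Gen
  | .L n => .L n
  | .H n => .H n
  | .Q n => .G (-1 - n)
  | .G n => .Q (-1 - n)

lemma Gen.partner_injective : Function.Injective Gen.partner := by
  intro i j h
  cases i <;> cases j <;> simp_all [Gen.partner]

lemma Gen.deg_of_odd {i : Gen} (h : i.Odd) : i.deg = 2 := by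
  cases i <;> simp_all [Gen.Odd, Gen.deg]

lemma Gen.deg_le (i : Gen) : 2 ≤ i.deg ∧ i.deg ≤ 4 ∧ (¬ i.Odd → 3 ≤ i.deg) := by
  cases i <;> simp only [Gen.Odd, Gen.deg] <;> (try split_ifs) <;> simp

/-- Two odd modes have total degree 4, which `L_{-1}` alone attains among single modes; a bracket
involving an even mode always loses degree. To leading order the algebra is therefore a Clifford
algebra over commuting even modes, with each odd mode paired to its partner. -/
lemma Gen.deg_br {c : ℂ} {i j k : Gen} (h : k ∈ (Gen.br c i j).1.support) :
    k.deg ≤ i.deg + j.deg ∧ (k.deg ≤ i.deg + j.deg - 1 ∨ i.Odd ∧ j.Odd ∧ j = i.partner) := by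
  obtain ⟨h1, h2⟩ := Gen.mem_support_br h
  cases i <;> cases j <;> cases k <;>
    simp only [Gen.ch, Gen.idx, Gen.deg, Gen.Odd, Gen.partner, Gen.Q.injEq, Gen.G.injEq,
      reduceCtorEq, false_and, and_false, or_false, true_and] at * <;>
    (try split_ifs) <;> omega

/-- The odd modes `i` and `partner i` supercommute to `2 L_{-1}` up to terms of lower degree. -/
lemma Gen.deg_br_partner {c : ℂ} {i k : Gen} (hi : i.Odd)
    (h : k ∈ ((Gen.br c i i.partner).1 - (2 : ℂ) • single (Gen.L (-1)) 1).support) :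
    k.deg ≤ 3 := by
  classical
  rw [Finsupp.mem_support_iff] at h
  cases i with
  | L n => exact hi.elim
  | H n => exact hi.elim
  | Q n =>
    simp only [Gen.partner, Gen.br, show n + (-1 - n) = -1 by ring, sub_sub_cancel_left,
      Finsupp.neg_apply, Finsupp.smul_apply, Finsupp.single_apply] at h
    split_ifs at h with hk
    · rw [← hk]; simp [Gen.deg]
    · simp at h
  | G n =>
    simp only [Gen.partner, Gen.br, show n + (-1 - n) = -1 by ring, sub_sub_cancel_left,
      Finsupp.neg_apply, Finsupp.smul_apply, Finsupp.single_apply] at h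
    split_ifs at h with hk
    · rw [← hk]; simp [Gen.deg]
    · simp at h

lemma compatible_deg {c : ℂ} {q p : ℤ} {a b : ℂ} (hw : WeightOK c q p a b) :
    (hwChar c q p a b hw).Compatible Gen.deg where
  br i j k hk := (Gen.deg_br hk).1
  sc i j _ := by linarith [i.deg_le.1, j.deg_le.1]
  char i _ _ := by linarith [i.deg_le.1]

namespace SuperLie.Character

section TT

variable {c : ℂ} {C : (superData c).Character} [LinearOrder Gen]

variable (C) in
/-- The action of a word on the span of the words. -/
noncomputable def TT (W : List Gen) : Module.End ℂ (List Gen →₀ ℂ) := (W.map C.T).prod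

lemma TT_nil (y : List Gen →₀ ℂ) : C.TT [] y = y := by simp [TT]

lemma TT_cons (i : Gen) (W : List Gen) (y : List Gen →₀ ℂ) :
    C.TT (i :: W) y = C.T i (C.TT W y) := by simp [TT]

lemma TT_append (V W : List Gen) (y : List Gen →₀ ℂ) : C.TT (V ++ W) y = C.TT V (C.TT W y) := by
  simp [TT]

lemma TT_mem_stdSub (W : List Gen) {y : List Gen →₀ ℂ} (hy : y ∈ C.stdSub) :
    C.TT W y ∈ C.stdSub := by
  induction W with
  | nil => rwa [TT_nil]
  | cons i W ih => rw [TT_cons]; exact C.T_mem_stdSub ih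

lemma toMod_TT {M : Type*} [AddCommGroup M] [Module ℂ M] [Module (Alg c) M]
    [IsScalarTower ℂ (Alg c) M] {v : M} (hv : C.IsHW v) (W : List Gen) {y : List Gen →₀ ℂ}
    (hy : y ∈ C.stdSub) : toMod c v (C.TT W y) = word c W • toMod c v y := by
  induction W with
  | nil => simp [TT_nil, word]
  | cons i W ih => rw [TT_cons, C.toMod_T hv i (TT_mem_stdSub W hy), ih, word_cons, mul_smul]

lemma TT_single_nil {W : List Gen} (hW : C.Std W) : C.TT W (single [] 1) = single W 1 := by
  induction W with
  | nil => rw [TT_nil]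
  | cons i W ih =>
    obtain ⟨hi, hW'⟩ := C.std_cons.1 hW
    rw [TT_cons, ih hW', T_single, C.act_ok hi]

lemma Compatible.TT_mem {μ : Gen → ℤ} (hμ : C.Compatible μ) (W : List Gen) {e : ℤ}
    {y : List Gen →₀ ℂ} (hy : y ∈ C.filt μ e) : C.TT W y ∈ C.filt μ ((W.map μ).sum + e) := by
  induction W with
  | nil => simpa [TT_nil] using hy
  | cons i W ih =>
    rw [TT_cons, List.map_cons, List.sum_cons, add_assoc]
    exact hμ.T_mem i ih

lemma filt_le_stdSub {μ : Gen → ℤ} {e : ℤ} : C.filt μ e ≤ C.stdSub :=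
  supported_mono fun _ h => h.1

lemma Compatible.ev_mem {μ : Gen → ℤ} (hμ : C.Compatible μ) {x : (Gen →₀ ℂ) × ℂ} {m e : ℤ}
    (h0 : 0 ≤ m) (hx : ∀ k ∈ x.1.support, μ k ≤ m) {y : List Gen →₀ ℂ} (hy : y ∈ C.filt μ e) :
    ev C.T x y ∈ C.filt μ (m + e) := by
  rw [ev_end_apply]
  refine Submodule.add_mem _ (Submodule.sum_mem _ fun k hk => Submodule.smul_mem _ _ ?_)
    (Submodule.smul_mem _ _ (C.filt_mono (by linarith) hy))
  exact C.filt_mono (by linarith [hx k hk]) (hμ.T_mem k hy)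

end TT

section Leading

variable {c : ℂ} {C : (superData c).Character} [LinearOrder Gen] (hC : C.Compatible Gen.deg)

include hC

lemma supercomm_mem {i j : Gen} (hij : ¬ (i.Odd ∧ j = i.partner)) {e : ℤ}
    {y : List Gen →₀ ℂ} (hy : y ∈ C.filt Gen.deg e) :
    C.T i (C.T j y) - (superData c).sgn i j • C.T j (C.T i y) ∈
      C.filt Gen.deg (i.deg + j.deg + e - 1) := by
  have h := C.comm_of_mem_stdSub (filt_le_stdSub hy) i j
  unfold Comm at h
  rw [h]
  refine C.filt_mono (by linarith) (hC.ev_mem (m := i.deg + j.deg - 1) ?_ (fun k hk => ?_) hy)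
  · linarith [i.deg_le.1, j.deg_le.1]
  · exact (Gen.deg_br hk).2.resolve_right fun h => hij ⟨h.1, h.2.2⟩

lemma anticomm_partner_mem {i : Gen} (hi : i.Odd) {e : ℤ}
    {y : List Gen →₀ ℂ} (hy : y ∈ C.filt Gen.deg e) :
    C.T i (C.T i.partner y) + C.T i.partner (C.T i y) - (2 : ℂ) • C.T (.L (-1)) y ∈
      C.filt Gen.deg (e + 3) := by
  have h := C.comm_of_mem_stdSub (filt_le_stdSub hy) i i.partner
  unfold Comm at h
  have ho : i.partner.Odd := by cases i <;> simp_all [Gen.Odd, Gen.partner]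
  rw [(superData c).sgn_odd _ _ hi ho] at h
  have h2 : ev C.T ((2 : ℂ) • single (Gen.L (-1)) 1, 0) y = (2 : ℂ) • C.T (.L (-1)) y := by
    rw [ev_end_apply, ← Finsupp.linearCombination_apply]
    simp
  have h3 : C.T i (C.T i.partner y) + C.T i.partner (C.T i y) - (2 : ℂ) • C.T (.L (-1)) y =
      ev C.T ((superData c).br i i.partner - ((2 : ℂ) • single (Gen.L (-1)) 1, 0)) y := by
    rw [map_sub, LinearMap.sub_apply, h2, ← h]
    module
  rw [h3]
  refine C.filt_mono (by linarith) (hC.ev_mem (m := 3) (by norm_num) (fun k hk => ?_) hy)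
  exact Gen.deg_br_partner hi hk

lemma TT_L_mem (W : List Gen) {e : ℤ} {y : List Gen →₀ ℂ} (hy : y ∈ C.filt Gen.deg e) :
    C.TT W (C.T (.L (-1)) y) - C.T (.L (-1)) (C.TT W y) ∈
      C.filt Gen.deg ((W.map Gen.deg).sum + e + 3) := by
  induction W with
  | nil => simp [TT_nil]
  | cons i W ih =>
    rw [TT_cons, TT_cons]
    have h1 := hC.T_mem i ih
    have h2 := supercomm_mem hC (i := .L (-1)) (j := i) (by simp [Gen.Odd]) (hC.TT_mem W hy)
    rw [(superData c).sgn_even (.L (-1)) i (fun h => h), one_smul] at h2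
    rw [map_sub] at h1
    rw [List.map_cons, List.sum_cons]
    have h3 := Submodule.sub_mem _ h1 (C.filt_mono (e' := i.deg + ((W.map Gen.deg).sum + e + 3))
      (by simp [Gen.deg]; linarith) h2)
    convert C.filt_mono (e' := i.deg + (W.map Gen.deg).sum + e + 3) (by linarith) h3 using 1
    abel

lemma TT_L_pow_mem (W : List Gen) (n : ℕ) {e : ℤ} {y : List Gen →₀ ℂ}
    (hy : y ∈ C.filt Gen.deg e) :
    C.TT W (C.TT (List.replicate n (.L (-1))) y) - C.TT (List.replicate n (.L (-1))) (C.TT W y) ∈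
      C.filt Gen.deg ((W.map Gen.deg).sum + e + 4 * n - 1) := by
  induction n with
  | zero => simp [TT_nil]
  | succ n ih =>
    rw [List.replicate_succ, TT_cons, TT_cons]
    have h1 := hC.T_mem (.L (-1)) ih
    have h2 := TT_L_mem hC W (hC.TT_mem (List.replicate n (.L (-1))) hy)
    rw [map_sub] at h1
    have h3 := Submodule.add_mem _
      (C.filt_mono (e' := (W.map Gen.deg).sum + e + 4 * (n + 1 : ℕ) - 1)
        (by simp [Gen.deg]; linarith) h1)
      (C.filt_mono (e' := (W.map Gen.deg).sum + e + 4 * (n + 1 : ℕ) - 1)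
        (by simp [Gen.deg]; linarith) h2)
    convert h3 using 1
    abel

variable (hχ : ∀ j, j.Odd → j ∉ C.N → C.χ j = 0)

omit hC [LinearOrder Gen] in
lemma sum_deg_of_odd {U : List Gen} (hU : ∀ k ∈ U, k.Odd) :
    (U.map Gen.deg).sum = 2 * U.length := by
  induction U with
  | nil => simp
  | cons k U ih =>
    rw [List.map_cons, List.sum_cons, ih fun l hl => hU l (by simp [hl]),
      Gen.deg_of_odd (hU k (by simp)), List.length_cons]
    push_cast
    ring

include hχ

omit hC hχ in
lemma vac_mem : (single [] 1 : List Gen →₀ ℂ) ∈ C.filt Gen.deg 0 :=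
  C.single_mem_filt C.std_nil (by simp)

/-- To leading order `j` anticommutes with every letter of `U` and then kills the vacuum. The
expected degree is `2 * U.length + 2`, so the bound says that the leading term vanishes. -/
lemma T_TT_mem_of_notMem {j : Gen} (hj : j.Odd) (hjN : j ∉ C.N) {U : List Gen}
    (hU : ∀ k ∈ U, k.Odd) (h : j.partner ∉ U) :
    C.T j (C.TT U (single [] 1)) ∈ C.filt Gen.deg (2 * U.length + 1) := by
  induction U with
  | nil =>
    rw [TT_nil, T_single, C.act_nil_of_notMem hjN, hχ j hj hjN, zero_smul]
    exact Submodule.zero_mem _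
  | cons k U ih =>
    rw [List.mem_cons, not_or] at h
    have hU' : ∀ l ∈ U, l.Odd := fun l hl => hU l (by simp [hl])
    have hk : k.Odd := hU k (by simp)
    have hy := hC.TT_mem U (vac_mem (C := C))
    rw [sum_deg_of_odd hU'] at hy
    have h1 := supercomm_mem hC (i := j) (j := k) (fun h' => h.1 h'.2.symm) hy
    rw [(superData c).sgn_odd j k hj hk, Gen.deg_of_odd hj, Gen.deg_of_odd hk] at h1
    have h2 := hC.T_mem k (ih hU' h.2)
    rw [Gen.deg_of_odd hk] at h2
    rw [TT_cons]
    have h3 := Submodule.sub_mem _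
      (C.filt_mono (e' := 2 * ((k :: U).length : ℤ) + 1) (by simp; linarith) h1)
      (C.filt_mono (e' := 2 * ((k :: U).length : ℤ) + 1) (by simp; linarith) h2)
    convert h3 using 1
    module

/-- `j` passes the letters before its partner by signs and is traded with the partner for `2
L_{-1}`; the term in which it travels on to the vacuum has lower degree. The scalar is 2 up to sign.
-/
lemma T_TT_mem_of_mem {j : Gen} (hj : j.Odd) (hjN : j ∉ C.N) {U : List Gen}
    (hU : ∀ k ∈ U, k.Odd) (hnd : U.Nodup) (h : j.partner ∈ U) :
    ∃ s : ℂ, s ≠ 0 ∧ C.T j (C.TT U (single [] 1))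
        - s • C.T (.L (-1)) (C.TT (U.erase j.partner) (single [] 1)) ∈
      C.filt Gen.deg (2 * U.length + 1) := by
  induction U with
  | nil => simp at h
  | cons k U ih =>
    have hU' : ∀ l ∈ U, l.Odd := fun l hl => hU l (by simp [hl])
    have hk : k.Odd := hU k (by simp)
    have hy := hC.TT_mem U (vac_mem (C := C))
    rw [sum_deg_of_odd hU'] at hy
    rw [List.nodup_cons] at hnd
    by_cases hkj : k = j.partner
    · subst hkj
      refine ⟨2, two_ne_zero, ?_⟩
      rw [List.erase_cons_head, TT_cons]
      have h1 := anticomm_partner_mem hC hj hy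
      have h2 := hC.T_mem j.partner (T_TT_mem_of_notMem hC hχ hj hjN hU' hnd.1)
      rw [Gen.deg_of_odd hk] at h2
      have h3 := Submodule.sub_mem _
        (C.filt_mono (e' := 2 * ((j.partner :: U).length : ℤ) + 1) (by simp; linarith) h1)
        (C.filt_mono (e' := 2 * ((j.partner :: U).length : ℤ) + 1) (by simp; linarith) h2)
      convert h3 using 1
      module
    · have hjU : j.partner ∈ U := (List.mem_cons.1 h).resolve_left fun h => hkj h.symm
      obtain ⟨s, hs, h0⟩ := ih hU' hnd.2 hjU
      refine ⟨-s, neg_ne_zero.2 hs, ?_⟩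
      rw [List.erase_cons_tail (by simpa using hkj), TT_cons, TT_cons]
      have hlen : ((U.erase j.partner).length : ℤ) = U.length - 1 := by
        have := List.length_erase_add_one hjU
        omega
      have hz := hC.TT_mem (U.erase j.partner) (vac_mem (C := C))
      rw [sum_deg_of_odd fun l hl => hU' l (List.mem_of_mem_erase hl), hlen] at hz
      have h1 := supercomm_mem hC (i := j) (j := k) (fun h' => hkj h'.2) hy
      rw [(superData c).sgn_odd j k hj hk, Gen.deg_of_odd hj, Gen.deg_of_odd hk] at h1
      have h2 := hC.T_mem k h0
      rw [Gen.deg_of_odd hk, map_sub, map_smul] at h2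
      have h4 := TT_L_mem hC [k] hz
      rw [TT_cons, TT_cons, TT_nil, TT_nil] at h4
      simp only [List.map_cons, List.map_nil, List.sum_cons, List.sum_nil,
        Gen.deg_of_odd hk] at h4
      have h3 := Submodule.sub_mem _ (Submodule.sub_mem _
        (C.filt_mono (e' := 2 * ((k :: U).length : ℤ) + 1) (by simp; linarith) h1)
        (C.filt_mono (e' := 2 * ((k :: U).length : ℤ) + 1) (by simp; linarith) h2))
        (Submodule.smul_mem _ s
        (C.filt_mono (e' := 2 * ((k :: U).length : ℤ) + 1) (by simp; linarith) h4))
      convert h3 using 1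
      module

/-- Distinct letters of `V` have distinct partners, so each finds its own partner still present, and
every contraction contributes one `L_{-1}`. -/
lemma TT_TT_mem {U : List Gen} (hU : ∀ k ∈ U, k.Odd) (hnd : U.Nodup) (V : List Gen)
    (hV : ∀ j ∈ V, j.Odd ∧ j ∉ C.N ∧ j.partner ∈ U) (hVnd : V.Nodup) :
    ∃ s : ℂ, s ≠ 0 ∧ C.TT V (C.TT U (single [] 1)) - s • C.TT (List.replicate V.length (.L (-1)))
        (C.TT (U.filter fun k => k ∉ V.map Gen.partner) (single [] 1)) ∈
      C.filt Gen.deg (2 * V.length + 2 * U.length - 1) ∧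
      (U.filter fun k => k ∉ V.map Gen.partner).length + V.length = U.length := by
  induction V with
  | nil => exact ⟨1, one_ne_zero, by simp [TT_nil], by simp⟩
  | cons j V ih =>
    rw [List.nodup_cons] at hVnd
    obtain ⟨hj, hjN, hjU⟩ := hV j (by simp)
    obtain ⟨s, hs, h1, hlen⟩ := ih (fun l hl => hV l (by simp [hl])) hVnd.2
    set U1 := U.filter fun k => k ∉ V.map Gen.partner with hU1
    have hU1odd : ∀ k ∈ U1, k.Odd := fun k hk => hU k (List.mem_of_mem_filter hk)
    have hjU1 : j.partner ∈ U1 := by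
      rw [hU1, List.mem_filter]
      refine ⟨hjU, ?_⟩
      simp only [List.mem_map, not_exists, not_and, decide_eq_true_eq]
      intro l hl he
      exact hVnd.1 (Gen.partner_injective he ▸ hl)
    have hU2 : (U.filter fun k => k ∉ (j :: V).map Gen.partner) = U1.erase j.partner := by
      rw [(hnd.filter _).erase_eq_filter, List.filter_filter]
      refine List.filter_congr fun k _ => ?_
      rw [Bool.eq_iff_iff]
      simp [bne_iff_ne]
    have hlen2 := List.length_erase_add_one hjU1
    rw [hU2]
    obtain ⟨s', hs', h2⟩ := T_TT_mem_of_mem hC hχ hj hjN hU1odd (hnd.filter _) hjU1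
    refine ⟨s * s', mul_ne_zero hs hs', ?_, by simp; omega⟩
    have hy := hC.TT_mem U1 (vac_mem (C := C))
    rw [sum_deg_of_odd hU1odd] at hy
    have h3 := TT_L_pow_mem hC [j] V.length hy
    have h4 := hC.TT_mem (List.replicate V.length (.L (-1))) h2
    have h5 := hC.T_mem j h1
    rw [map_sub, map_smul] at h4 h5
    rw [TT_cons, TT_cons, TT_nil, TT_nil] at h3
    simp only [List.map_cons, List.map_nil, List.sum_cons, List.sum_nil, List.map_replicate,
      List.sum_replicate, Gen.deg_of_odd hj, nsmul_eq_mul] at h3 h4 h5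
    rw [TT_cons, List.length_cons, List.replicate_succ', TT_append, TT_cons, TT_nil]
    have hL : Gen.deg (.L (-1)) = 4 := rfl
    rw [hL] at h4
    have hlenZ : (U1.length : ℤ) + V.length = U.length := by exact_mod_cast hlen
    have h6 := Submodule.add_mem _ (Submodule.add_mem _
      (C.filt_mono (e' := 2 * ((V.length + 1 : ℕ) : ℤ) + 2 * U.length - 1)
        (by push_cast; linarith) h5)
      (Submodule.smul_mem _ s (C.filt_mono
        (e' := 2 * ((V.length + 1 : ℕ) : ℤ) + 2 * U.length - 1) (by push_cast; linarith) h3)))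
      (Submodule.smul_mem _ s (C.filt_mono
        (e' := 2 * ((V.length + 1 : ℕ) : ℤ) + 2 * U.length - 1) (by push_cast; linarith) h4))
    convert h6 using 1
    module

end Leading

end SuperLie.Character

/-! ### Independence of the descendants of a product of odd modes -/

open SuperLie Finsupp

namespace SuperLie.Character

section Embedding

variable {c : ℂ} [LinearOrder Gen]

/-- The data of a product `U` of odd modes of a module of type `C` that yields a highest-weight
vector of type `C'`. -/
structure Embeds (C C' : (superData c).Character) (U : List Gen) : Prop where
  compat : C.Compatible Gen.deg
  char : ∀ j, j.Odd → j ∉ C.N → C.χ j = 0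
  std : C.Std U
  odd : ∀ k ∈ U, k.Odd
  notMem : ∀ k ∈ U, k ∉ C'.N
  partner : ∀ j ∈ C'.N, j ∉ C.N → j.Odd ∧ j.partner ∈ U
  L_mem : Gen.L (-1) ∈ C.N
  L_lt : ∀ g, g ≠ Gen.L (-1) → Gen.L (-1) < g
  lt_of_mem : ∀ i ∈ C'.N, i ∉ C.N → ∀ j ∈ C'.N, j ∈ C.N → j < i
  lt_U : ∀ i ∈ C'.N, i ∈ C.N → ∀ k ∈ U, i < k

open Classical in
/-- The letters of a word that are creation modes of `C`. -/
noncomputable def inner (C : (superData c).Character) (W : List Gen) : List Gen :=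
  W.filter fun g => g ∈ C.N

open Classical in
/-- The letters of a word that are not creation modes of `C`. -/
noncomputable def outer (C : (superData c).Character) (W : List Gen) : List Gen :=
  W.filter fun g => g ∉ C.N

/-- The leading word of `W U` in the module of type `C`. -/
noncomputable def leading (C : (superData c).Character) (U W : List Gen) : List Gen :=
  List.replicate (C.outer W).length (.L (-1)) ++
    (C.inner W ++ U.filter fun k => k ∉ (C.outer W).map Gen.partner)

variable {C C' : (superData c).Character} {U : List Gen}

lemma nodup_of_std_odd {W : List Gen} (hW : W.Pairwise (superData c).R) (ho : ∀ k ∈ W, k.Odd) :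
    W.Nodup := by
  refine hW.imp_of_mem fun {a b} ha _ h => ?_
  rintro rfl
  rcases h with h | h
  · exact lt_irrefl _ h
  · exact h.2 (ho _ ha)

/-- The order puts the creation modes common to `C` and `C'` before those of `C'` alone, so the
letters that contract with `U` stand next to it. -/
lemma Embeds.eq_append (h : Embeds C C' U) {W : List Gen} (hW : C'.Std W) :
    W = C.inner W ++ C.outer W := by
  classical
  induction W with
  | nil => simp [inner, outer]
  | cons i W ih =>
    obtain ⟨hi, hW'⟩ := C'.std_cons.1 hW
    have ih := ih hW'
    by_cases hiN : i ∈ C.N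
    · rw [inner, outer, List.filter_cons_of_pos (by simpa using hiN),
        List.filter_cons_of_neg (by simpa using hiN), List.cons_append]
      exact congrArg _ ih
    · have hall : ∀ j ∈ W, j ∉ C.N := by
        intro j hj hjN
        have h1 := h.lt_of_mem i hi.1 hiN j (hW'.2 j hj) hjN
        rcases hi.2 j hj with h2 | h2
        · exact lt_asymm h1 h2
        · exact hiN (h2.1 ▸ hjN)
      have e1 : W.filter (fun g => g ∈ C.N) = [] := by
        rw [List.filter_eq_nil_iff]
        intro j hj
        simpa using hall j hj
      have e2 : W.filter (fun g => g ∉ C.N) = W := by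
        rw [List.filter_eq_self]
        intro j hj
        simpa using hall j hj
      rw [inner, outer, List.filter_cons_of_neg (by simpa using hiN),
        List.filter_cons_of_pos (by simpa using hiN), e1, e2]
      rfl

omit [LinearOrder Gen] in
lemma mem_inner {W : List Gen} {g : Gen} : g ∈ C.inner W ↔ g ∈ W ∧ g ∈ C.N := by
  classical
  simp [inner, List.mem_filter]

omit [LinearOrder Gen] in
lemma mem_outer {W : List Gen} {g : Gen} : g ∈ C.outer W ↔ g ∈ W ∧ g ∉ C.N := by
  classical
  simp [outer, List.mem_filter]

lemma Embeds.outer_spec (h : Embeds C C' U) {W : List Gen} (hW : C'.Std W) :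
    (∀ j ∈ C.outer W, j.Odd ∧ j ∉ C.N ∧ j.partner ∈ U) ∧ (C.outer W).Nodup ∧
      (C.outer W).Pairwise (superData c).R := by
  classical
  have h1 : ∀ j ∈ C.outer W, j.Odd ∧ j ∉ C.N ∧ j.partner ∈ U := by
    intro j hj
    obtain ⟨hjW, hjN⟩ := mem_outer.1 hj
    obtain ⟨ho, hp⟩ := h.partner j (hW.2 j hjW) hjN
    exact ⟨ho, hjN, hp⟩
  have h2 : (C.outer W).Pairwise (superData c).R := hW.1.sublist List.filter_sublist
  exact ⟨h1, nodup_of_std_odd h2 fun k hk => (h1 k hk).1, h2⟩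

lemma Embeds.std_leading (h : Embeds C C' U) {W : List Gen} (hW : C'.Std W) :
    C.Std (C.leading U W) := by
  classical
  refine ⟨?_, fun g hg => ?_⟩
  · rw [leading, List.pairwise_append, List.pairwise_append]
    refine ⟨List.pairwise_replicate.2 (Or.inr (Or.inr ⟨rfl, fun h => h⟩)),
      ⟨hW.1.sublist List.filter_sublist, h.std.1.sublist List.filter_sublist, ?_⟩, ?_⟩
    · intro i hi k hk
      obtain ⟨h1, h2⟩ := mem_inner.1 hi
      exact Or.inl (h.lt_U i (hW.2 i h1) h2 k (List.mem_of_mem_filter hk))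
    · intro i hi k _
      rw [List.eq_of_mem_replicate hi]
      by_cases hk : k = Gen.L (-1)
      · exact Or.inr ⟨hk.symm, fun h => h⟩
      · exact Or.inl (h.L_lt k hk)
  · rw [leading, List.mem_append, List.mem_append] at hg
    rcases hg with hg | hg | hg
    · rw [List.eq_of_mem_replicate hg]; exact h.L_mem
    · exact (mem_inner.1 hg).2
    · exact h.std.2 g (List.mem_of_mem_filter hg)

/-- No letter of `U` is a creation mode of `C'` or equals `L_{-1}`, so the surviving letters of `U`
can be read off from the leading word. The missing ones reveal the partners, hence `outer`, which is
sorted; `inner` follows by cancellation. -/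
lemma Embeds.leading_injective (h : Embeds C C' U) {W W' : List Gen} (hW : C'.Std W)
    (hW' : C'.Std W') (he : C.leading U W = C.leading U W') : W = W' := by
  classical
  have hfilter : ∀ V, C'.Std V → (C.leading U V).filter (fun k => k ∈ U) =
      U.filter fun k => k ∉ (C.outer V).map Gen.partner := by
    intro V hV
    rw [leading, List.filter_append, List.filter_append]
    have e1 : (List.replicate (C.outer V).length (Gen.L (-1))).filter (fun k => k ∈ U) = [] := by
      rw [List.filter_eq_nil_iff]
      intro g hg
      rw [List.eq_of_mem_replicate hg]
      have : Gen.L (-1) ∉ U := h.odd (Gen.L (-1))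
      simpa using this
    have e2 : (C.inner V).filter (fun k => k ∈ U) = [] := by
      rw [List.filter_eq_nil_iff]
      intro g hg
      simpa using fun hm => h.notMem g hm (hV.2 g (mem_inner.1 hg).1)
    rw [e1, e2, List.nil_append, List.nil_append, List.filter_eq_self]
    intro g hg
    simpa using List.mem_of_mem_filter hg
  have hU : (U.filter fun k => k ∉ (C.outer W).map Gen.partner) =
      U.filter fun k => k ∉ (C.outer W').map Gen.partner := by
    rw [← hfilter W hW, ← hfilter W' hW', he]
  have hsub : ∀ V V', C'.Std V → (U.filter fun k => k ∉ (C.outer V).map Gen.partner) =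
      (U.filter fun k => k ∉ (C.outer V').map Gen.partner) →
      ∀ j ∈ C.outer V, j ∈ C.outer V' := by
    intro V V' hV heq j hj
    by_contra hj'
    have h1 : j.partner ∈ U.filter fun k => k ∉ (C.outer V').map Gen.partner := by
      rw [List.mem_filter]
      refine ⟨((h.outer_spec hV).1 j hj).2.2, ?_⟩
      simp only [List.mem_map, not_exists, not_and, decide_eq_true_eq]
      intro l hl hlj
      exact hj' (Gen.partner_injective hlj ▸ hl)
    rw [← heq, List.mem_filter] at h1
    have h2 := h1.2
    simp only [List.mem_map, not_exists, not_and, decide_eq_true_eq] at h2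
    exact h2 j hj rfl
  have hperm : (C.outer W).Perm (C.outer W') :=
    (List.perm_ext_iff_of_nodup (h.outer_spec hW).2.1 (h.outer_spec hW').2.1).2 fun j =>
      ⟨hsub W W' hW hU j, hsub W' W hW' hU.symm j⟩
  have houter : C.outer W = C.outer W' := by
    refine hperm.eq_of_pairwise (fun a b _ _ h1 h2 => ?_) (h.outer_spec hW).2.2
      (h.outer_spec hW').2.2
    rcases h1 with h1 | h1
    · rcases h2 with h2 | h2
      · exact absurd h2 (lt_asymm h1)
      · exact h2.1.symm
    · exact h1.1
  rw [leading, leading, houter] at he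
  have hinner := List.append_cancel_right (List.append_cancel_left he)
  rw [h.eq_append hW, h.eq_append hW', hinner, houter]

omit [LinearOrder Gen] in
lemma sum_deg_append (V W : List Gen) :
    ((V ++ W).map Gen.deg).sum = (V.map Gen.deg).sum + (W.map Gen.deg).sum := by
  rw [List.map_append, List.sum_append]

/-- The leading term of the action of a standard word of type `C'` on `U`. -/
lemma Embeds.exists_leading (h : Embeds C C' U) {W : List Gen} (hW : C'.Std W) :
    ((C.leading U W).map Gen.deg).sum = (W.map Gen.deg).sum + 2 * U.length ∧
    ∃ s : ℂ, s ≠ 0 ∧ C.TT W (C.TT U (single [] 1)) - s • single (C.leading U W) 1 ∈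
      C.filt Gen.deg ((W.map Gen.deg).sum + 2 * U.length - 1) := by
  obtain ⟨h1, h2, h3⟩ := h.outer_spec hW
  have hUnd := nodup_of_std_odd h.std.1 h.odd
  obtain ⟨s, hs, h4, h5⟩ := TT_TT_mem h.compat h.char h.odd hUnd (C.outer W) h1 h2
  set U' := U.filter fun k => k ∉ (C.outer W).map Gen.partner with hU'
  have hU'odd : ∀ k ∈ U', k.Odd := fun k hk => h.odd k (List.mem_of_mem_filter hk)
  have hdegW : (W.map Gen.deg).sum = ((C.inner W).map Gen.deg).sum + 2 * (C.outer W).length := by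
    conv_lhs => rw [h.eq_append hW]
    rw [sum_deg_append, sum_deg_of_odd fun k hk => (h1 k hk).1]
  have h5' : (U'.length : ℤ) + (C.outer W).length = U.length := by exact_mod_cast h5
  have hL : Gen.deg (.L (-1)) = 4 := rfl
  refine ⟨?_, s, hs, ?_⟩
  · rw [leading, sum_deg_append, sum_deg_append, ← hU', sum_deg_of_odd hU'odd, hdegW]
    simp only [List.map_replicate, List.sum_replicate, nsmul_eq_mul, hL]
    linarith
  · have hy := h.compat.TT_mem U' (vac_mem (C := C))
    rw [sum_deg_of_odd hU'odd] at hy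
    have h6 := h.compat.TT_mem (C.inner W) h4
    have h7 := TT_L_pow_mem h.compat (C.inner W) (C.outer W).length hy
    have hlead : C.TT (List.replicate (C.outer W).length (.L (-1)))
        (C.TT (C.inner W) (C.TT U' (single [] 1))) = single (C.leading U W) 1 := by
      rw [← TT_append, ← TT_append]
      have := TT_single_nil (h.std_leading hW)
      rwa [leading, List.append_assoc] at *
    rw [hlead] at h7
    rw [map_sub, map_smul, ← TT_append, ← h.eq_append hW] at h6
    have h8 := Submodule.add_mem _
      (C.filt_mono (e' := (W.map Gen.deg).sum + 2 * U.length - 1) (by linarith) h6)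
      (Submodule.smul_mem _ s (C.filt_mono (e' := (W.map Gen.deg).sum + 2 * U.length - 1)
        (by linarith) h7))
    convert h8 using 1
    module

lemma apply_eq_zero_of_mem_filt {μ : Gen → ℤ} {e : ℤ} {z : List Gen →₀ ℂ} (hz : z ∈ C.filt μ e)
    {K : List Gen} (hK : e < (K.map μ).sum) : z K = 0 := by
  by_contra h
  have := (mem_filt_iff.1 hz K (Finsupp.mem_support_iff.2 h)).2
  omega

/-- The standard words of type `C'` act independently on `U`. -/
theorem Embeds.eq_zero (h : Embeds C C' U) {M : Type*} [AddCommGroup M] [Module ℂ M]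
    [Module (Alg c) M] [IsScalarTower ℂ (Alg c) M] {v : M} (hv : C.IsFree v)
    {y : List Gen →₀ ℂ} (hy : y ∈ C'.stdSub) (h0 : toMod c (word c U • v) y = 0) : y = 0 := by
  have hvac : (single [] 1 : List Gen →₀ ℂ) ∈ C.stdSub := C.single_mem_stdSub C.std_nil
  have hE := TT_mem_stdSub U hvac
  have hv0 : toMod c v (single [] 1) = v := by rw [toMod_single]; simp [word]
  have hsum : toMod c (word c U • v) y =
      toMod c v (y.sum fun W a => a • C.TT W (C.TT U (single [] 1))) := by
    rw [toMod, Finsupp.linearCombination_apply]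
    simp only [Finsupp.sum]
    rw [map_sum]
    refine Finset.sum_congr rfl fun W _ => ?_
    rw [map_smul, toMod_TT hv.hw W hE, toMod_TT hv.hw U hvac, hv0]
  rw [hsum] at h0
  have h1 := hv.inj _ (Submodule.sum_mem _ fun W _ =>
    Submodule.smul_mem _ _ (TT_mem_stdSub W hE)) h0
  have hstd : ∀ W ∈ y.support, C'.Std W := fun W hW => (mem_supported _ _).1 hy hW
  by_contra hne
  -- For a word of maximal degree, the coefficient of its leading word receives nothing from the
  -- others: their leading words differ and their remainders have lower degree.
  obtain ⟨W, hW, hmax⟩ := Finset.exists_max_image y.support (fun W => (W.map Gen.deg).sum)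
    (Finsupp.support_nonempty_iff.2 hne)
  have h2 := DFunLike.congr_fun h1 (C.leading U W)
  obtain ⟨hdeg, s, hs, hlow⟩ := h.exists_leading (hstd W hW)
  rw [Finsupp.finsetSum_apply, Finset.sum_eq_single W] at h2
  · have h3 := apply_eq_zero_of_mem_filt hlow (K := C.leading U W) (by omega)
    rw [Finsupp.sub_apply, sub_eq_zero] at h3
    rw [Finsupp.smul_apply, h3] at h2
    simp [hs] at h2
    exact (Finsupp.mem_support_iff.1 hW) h2
  · intro W' hW' hneW
    obtain ⟨_, s', _, hlow'⟩ := h.exists_leading (hstd W' hW')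
    have h3 := apply_eq_zero_of_mem_filt hlow' (K := C.leading U W) (by
      have := hmax W' hW'
      omega)
    rw [Finsupp.sub_apply, sub_eq_zero] at h3
    rw [Finsupp.smul_apply, h3, Finsupp.smul_apply, Finsupp.single_eq_of_ne]
    · simp
    · intro he
      exact hneW (h.leading_injective (hstd W' hW') (hstd W hW) he.symm)
  · intro hW'; exact absurd hW hW'

end Embedding

end SuperLie.Character

/-! ### The words of the charged singular vectors -/

open SuperLie Finsupp

section Words

lemma mem_Qword {a : ℤ} {k : ℕ} {g : Gen} :
    g ∈ Qword a k ↔ ∃ n, a ≤ n ∧ n < a + k ∧ g = .Q n := by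
  rw [Qword, List.mem_map]
  constructor
  · rintro ⟨i, hi, rfl⟩
    rw [List.mem_range] at hi
    exact ⟨a + i, by omega, by omega, rfl⟩
  · rintro ⟨n, h1, h2, rfl⟩
    refine ⟨(n - a).toNat, List.mem_range.2 (by omega), ?_⟩
    congr 1
    omega

lemma mem_Gword {a : ℤ} {k : ℕ} {g : Gen} :
    g ∈ Gword a k ↔ ∃ n, a ≤ n ∧ n < a + k ∧ g = .G n := by
  rw [Gword, List.mem_map]
  constructor
  · rintro ⟨i, hi, rfl⟩
    rw [List.mem_range] at hi
    exact ⟨a + i, by omega, by omega, rfl⟩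
  · rintro ⟨n, h1, h2, rfl⟩
    refine ⟨(n - a).toNat, List.mem_range.2 (by omega), ?_⟩
    congr 1
    omega

lemma Qword_succ (a : ℤ) (k : ℕ) : Qword a (k + 1) = .Q a :: Qword (a + 1) k := by
  simp only [Qword, List.range_succ_eq_map, List.map_cons, List.map_map, Nat.cast_zero, add_zero,
    List.cons.injEq, true_and]
  refine List.map_congr_left fun i _ => ?_
  simp only [Function.comp_apply, Nat.cast_succ]
  congr 1
  ring

lemma Gword_succ (a : ℤ) (k : ℕ) : Gword a (k + 1) = .G a :: Gword (a + 1) k := by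
  simp only [Gword, List.range_succ_eq_map, List.map_cons, List.map_map, Nat.cast_zero, add_zero,
    List.cons.injEq, true_and]
  refine List.map_congr_left fun i _ => ?_
  simp only [Function.comp_apply, Nat.cast_succ]
  congr 1
  ring

lemma Qprod_eq (c : ℂ) (a : ℤ) (k : ℕ) : Qprod c a k = word c (Qword a k) := by
  have h : (do let i ← List.range k; pure (i : ℤ)) = (List.range k).map (fun i : ℕ => (i : ℤ)) :=
    (List.map_eq_flatMap).symm
  rw [Qprod, word, Qword, h, List.map_map, List.map_map]
  rfl

lemma Gprod_eq (c : ℂ) (a : ℤ) (k : ℕ) : Gprod c a k = word c (Gword a k) := by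
  have h : (do let i ← List.range k; pure (i : ℤ)) = (List.range k).map (fun i : ℕ => (i : ℤ)) :=
    (List.map_eq_flatMap).symm
  rw [Gprod, word, Gword, h, List.map_map, List.map_map]
  rfl

/-- The modes that create the charged singular vector. -/
def chargedWord (r : ℤ) : List Gen := if r ≤ 0 then Qword r (1 - r).toNat else Gword (-r) r.toNat

lemma chargedVec_eq (r : ℤ) (h ℓ t : ℂ) :
    chargedVec r h ℓ t = word (centralCharge t) (chargedWord r) • massiveVec h ℓ t := by
  unfold chargedVec chargedWord
  split_ifs
  · rw [Qprod_eq]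
  · rw [Gprod_eq]

lemma of_mem_chargedWord {r : ℤ} {k : Gen} (hk : k ∈ chargedWord r) :
    k.Odd ∧ k ∈ creation 0 (-1) ∧ k ∉ creation (r - 1) (-r - 1) := by
  unfold chargedWord at hk
  split_ifs at hk with hr
  · obtain ⟨n, h1, h2, rfl⟩ := mem_Qword.1 hk
    exact ⟨trivial, Q_mem_creation.2 (by omega), fun h => by rw [Q_mem_creation] at h; omega⟩
  · obtain ⟨n, h1, h2, rfl⟩ := mem_Gword.1 hk
    exact ⟨trivial, G_mem_creation.2 (by omega), fun h => by rw [G_mem_creation] at h; omega⟩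

/-- For `r ≤ 0` the extra creation modes are `G_0, …, G_{-r-1}`, with partners `Q_{-1}, …, Q_r`; for
`r ≥ 1` they are `Q_1, …, Q_{r-1}`, with partners `G_{-2}, …, G_{-r}`. -/
lemma partner_mem_chargedWord {r : ℤ} {j : Gen} (h1 : j ∈ creation (r - 1) (-r - 1))
    (h2 : j ∉ creation 0 (-1)) : j.Odd ∧ j.partner ∈ chargedWord r := by
  cases j with
  | L n => exact absurd h1 h2
  | H n => exact absurd h1 h2
  | Q n =>
    simp only [Q_mem_creation] at h1 h2
    refine ⟨trivial, ?_⟩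
    rw [chargedWord, if_neg (by omega), mem_Gword]
    exact ⟨-1 - n, by omega, by omega, rfl⟩
  | G n =>
    simp only [G_mem_creation] at h1 h2
    refine ⟨trivial, ?_⟩
    rw [chargedWord, if_pos (by omega), mem_Qword]
    exact ⟨-1 - n, by omega, by omega, rfl⟩

lemma pairwise_chargedWord (r : ℤ) :
    (chargedWord r).Pairwise fun k l => k.tag = l.tag ∧ k.idx < l.idx := by
  unfold chargedWord
  split_ifs
  · rw [Qword, List.pairwise_map]
    exact List.pairwise_lt_range.imp fun h => ⟨rfl, by simpa [Gen.idx] using h⟩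
  · rw [Gword, List.pairwise_map]
    exact List.pairwise_lt_range.imp fun h => ⟨rfl, by simpa [Gen.idx] using h⟩

lemma chargedWord_ne_nil (r : ℤ) : chargedWord r ≠ [] := by
  intro h
  unfold chargedWord at h
  split_ifs at h with hr
  · have : Gen.Q r ∈ Qword r (1 - r).toNat := mem_Qword.2 ⟨r, le_rfl, by omega, rfl⟩
    simp [h] at this
  · have : Gen.G (-r) ∈ Gword (-r) r.toNat := mem_Gword.2 ⟨-r, le_rfl, by omega, rfl⟩
    simp [h] at this

end Words

/-! ### An order adapted to two sets of creation modes -/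

section Order

open Classical in
/-- The rank of a mode in the order that compares two sets of creation modes: first `L_{-1}`, then
the common modes, then the modes of `N` only, then the others. -/
noncomputable def compareRank (N N' : Set Gen) (g : Gen) : ℕ :=
  if g = .L (-1) then 0 else if g ∈ N then (if g ∈ N' then 1 else 2) else 3

lemma embeds_hwChar {c : ℂ} {q p q' p' : ℤ} {a b a' b' : ℂ} (hw : WeightOK c q p a b)
    (hw' : WeightOK c q' p' a' b') {U : List Gen}
    (hU : ∀ k ∈ U, k.Odd ∧ k ∈ creation q p ∧ k ∉ creation q' p')
    (hs : U.Pairwise fun k l => k.tag = l.tag ∧ k.idx < l.idx)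
    (hp : ∀ j ∈ creation q' p', j ∉ creation q p → j.Odd ∧ j.partner ∈ U) :
    letI := rankOrder (compareRank (creation q p) (creation q' p'))
    Character.Embeds (hwChar c q p a b hw) (hwChar c q' p' a' b' hw') U := by
  have hrU : ∀ k ∈ U, compareRank (creation q p) (creation q' p') k = 2 := by
    intro k hk
    obtain ⟨h1, h2, h3⟩ := hU k hk
    rw [compareRank, if_neg (by rintro rfl; exact h1), if_pos h2, if_neg h3]
  let _ := rankOrder (compareRank (creation q p) (creation q' p'))
  refine ⟨compatible_deg hw, fun j hj _ => ?_, ⟨?_, fun k hk => (hU k hk).2.1⟩,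
    fun k hk => (hU k hk).1, fun k hk => (hU k hk).2.2, hp, ?_, fun g hg => rankOrder_lt ?_,
    fun i hi hi' j hj hj' => rankOrder_lt ?_, fun i hi hi' k hk => rankOrder_lt ?_⟩
  · cases j with
    | L n => exact hj.elim
    | H n => exact hj.elim
    | Q n => rfl
    | G n => rfl
  · refine hs.imp_of_mem fun {k l} hk hl h => Or.inl ?_
    refine Prod.Lex.toLex_lt_toLex.2 (Or.inr ⟨(hrU k hk).trans (hrU l hl).symm, ?_⟩)
    exact Prod.Lex.toLex_lt_toLex.2 (Or.inr h)
  · exact L_mem_creation.2 le_rfl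
  · rw [compareRank, if_pos rfl, compareRank, if_neg hg]
    split_ifs <;> decide
  · change i ∉ creation q p at hi'
    have hi1 : i ≠ .L (-1) := by rintro rfl; exact hi' (L_mem_creation.2 le_rfl)
    have hjN : j ∈ creation q p := hj'
    have hjN' : j ∈ creation q' p' := hj
    rw [compareRank, compareRank, if_neg hi1, if_neg hi', if_pos hjN, if_pos hjN']
    split_ifs <;> decide
  · have hiN : i ∈ creation q p := hi'
    have hiN' : i ∈ creation q' p' := hi
    rw [hrU k hk, compareRank, if_pos hiN, if_pos hiN']
    split_ifs <;> decide

end Order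

/-! ### The flow chain and its broken link -/

section Chain

variable {c : ℂ} {M : Type*} [AddCommGroup M] [Module ℂ M] [Module (Alg c) M]
  [IsScalarTower ℂ (Alg c) M] {v : M} {h ℓ t : ℂ}

lemma isHW_Qword (hv : (massiveChar c 0 ℓ h).IsHW v) (k : ℕ) :
    (massiveChar c (-k) (ℓ + ((-k : ℤ) : ℂ) * (((-k : ℤ) : ℂ) + 1) / 2) (h + ((-k : ℤ) : ℂ))).IsHW
      (word c (Qword (1 - k) k) • v) := by
  induction k with
  | zero => simpa [Qword, word] using hv
  | succ k ih =>
    have h1 := isHW_flow_down ih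
    rw [show (1 : ℤ) - ((k + 1 : ℕ) : ℤ) = -k by push_cast; ring, Qword_succ, word_cons, mul_smul,
      show -(k : ℤ) + 1 = 1 - k by ring]
    convert h1 using 2 <;> push_cast <;> ring

lemma isHW_Gword (hv : (massiveChar c 0 ℓ h).IsHW v) (k : ℕ) :
    (massiveChar c k (ℓ + ((k : ℤ) : ℂ) * (((k : ℤ) : ℂ) + 1) / 2) (h + ((k : ℤ) : ℂ))).IsHW
      (word c (Gword (-k) k) • v) := by
  induction k with
  | zero => simpa [Gword, word] using hv
  | succ k ih =>
    have h1 := isHW_flow_up ih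
    rw [show -(((k + 1 : ℕ) : ℤ)) = -k - 1 by push_cast; ring, Gword_succ, word_cons, mul_smul,
      sub_add_cancel]
    convert h1 using 2 <;> push_cast <;> ring

end Chain

section Top

variable {h t : ℂ} {θ : ℤ} {M : Type*} [AddCommGroup M] [Module ℂ M]
  [Module (Alg (centralCharge t)) M] [IsScalarTower ℂ (Alg (centralCharge t)) M] {x : M}

/-- The `L_0` eigenvalue is forced, since `G_θ` and `Q_{-θ}` both kill `x` and hence so does their
anticommutator. -/
lemma isHW_top (hL : ∀ n, 1 ≤ n → mode (centralCharge t) (.L n) • x = 0)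
    (hH : ∀ n, 1 ≤ n → mode (centralCharge t) (.H n) • x = 0)
    (hQ : ∀ n, -θ ≤ n → mode (centralCharge t) (.Q n) • x = 0)
    (hG : ∀ n, θ ≤ n → mode (centralCharge t) (.G n) • x = 0)
    (hH0 : mode (centralCharge t) (.H 0) • x = topH h t θ • x) :
    (hwChar _ _ _ _ _ (weightOK_top h t θ)).IsHW x := by
  rw [isHW_hwChar_iff]
  refine ⟨hL, hH, fun n hn => hQ n (by omega), fun n hn => hG n (by omega), ?_, hH0⟩
  have h1 := G_Q_smul (c := centralCharge t) x θ (-θ)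
  rw [hQ _ le_rfl, hG _ le_rfl, smul_zero, smul_zero, add_zero, add_neg_cancel, hH0, delta,
    if_pos rfl] at h1
  generalize mode (centralCharge t) (.L 0) • x = y at h1 ⊢
  have h2 : (2 : ℂ) • (y - topL h t θ • x) = 0 := by
    refine Eq.trans ?_ h1.symm
    rw [topL]
    push_cast
    module
  exact sub_eq_zero.1 ((smul_eq_zero.1 h2).resolve_left two_ne_zero)

omit [IsScalarTower ℂ (Alg (centralCharge t)) M] in
lemma isTwistedTopHW_of_isHW (hx : (hwChar _ _ _ _ _ (weightOK_top h t θ)).IsHW x) :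
    IsTwistedTopHW h t θ x := by
  obtain ⟨hL, hH, hQ, hG, hL0, hH0⟩ := isHW_hwChar_iff.1 hx
  refine ⟨hL, hH, fun n hn => hQ n (by omega), fun n hn => hG n (by omega), ?_, ?_⟩
  · rw [← mode_H, hH0, ← add_smul, topH, sub_add_cancel]
  · rw [← mode_H, ← mode_L, hH0, hL0, topL]
    module

/-- The charged singular vector is a twisted topological highest-weight vector. -/
lemma isHW_chargedWord (ht : t ≠ 0) {ℓ : ℂ} {r : ℤ} (hr : ℓ = lch r h t)
    (hx : (massiveChar (centralCharge t) 0 ℓ h).IsHW x) :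
    ∃ h', (hwChar _ _ _ _ _ (weightOK_top h' t (-r))).IsHW
      (word (centralCharge t) (chargedWord r) • x) := by
  rw [chargedWord]
  split_ifs with h0
  · obtain ⟨k, hk⟩ := Int.eq_ofNat_of_zero_le (show 0 ≤ -r by omega)
    obtain rfl : r = -k := by omega
    rw [show (1 - (-(k : ℤ))).toNat = k + 1 by omega, Qword_succ, word_cons, mul_smul,
      show -(k : ℤ) + 1 = 1 - k by ring]
    -- The inner `k` modes give a massive vector of twist `-k`, and the outermost, `Q_{-k}`, lowers
    -- the twist to `-k - 1`. The only missing annihilation mode is `G_k`, and `G_k Q_{-k}` acts by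
    -- a flow factor that vanishes by the charged condition.
    have h1 := isHW_Qword hx k
    have h2 := flow_down_up h1
    obtain ⟨hL, hH, hQ, hG, -, hH0⟩ := isHW_hwChar_iff.1 (isHW_flow_down h1)
    -- The parameter is the `H_0` eigenvalue shifted by `c θ / 3` with `θ = -r`.
    refine ⟨_ + centralCharge t / 3 * ((-(-k) : ℤ) : ℂ), isHW_top hL hH
      (fun n hn => hQ n (by omega)) (fun n hn => ?_) (by rw [hH0, topH, add_sub_cancel_right])⟩
    rcases eq_or_ne n (- -(k : ℤ)) with rfl | hne
    · rw [h2]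
      have := flowFactor_eq (h := h) (ℓ := ℓ) ht (-(k : ℤ) - 1)
      rw [sub_add_cancel, ← hr, sub_self, mul_zero] at this
      have h3 : flowFactor (centralCharge t) (-(k : ℤ) - 1)
          (ℓ + ((-k : ℤ) : ℂ) * (((-k : ℤ) : ℂ) + 1) / 2 - ((-k : ℤ) : ℂ))
          (h + ((-k : ℤ) : ℂ) - 1) = 0 := by
        rw [← this]
        congr 1 <;> push_cast <;> ring
      rw [h3, zero_smul]
    · exact hG n (by omega)
  · obtain ⟨k, hk⟩ := Int.eq_ofNat_of_zero_le (show 0 ≤ r - 1 by omega)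
    obtain rfl : r = k + 1 := by omega
    rw [show ((k : ℤ) + 1).toNat = k + 1 by omega, Gword_succ, word_cons, mul_smul,
      show -((k : ℤ) + 1) + 1 = -k by ring, show -((k : ℤ) + 1) = -k - 1 by ring]
    have h1 := isHW_Gword hx k
    have h2 := flow_up_down h1
    obtain ⟨hL, hH, hQ, hG, -, hH0⟩ := isHW_hwChar_iff.1 (isHW_flow_up h1)
    refine ⟨_ + centralCharge t / 3 * ((-(k : ℤ) - 1 : ℤ) : ℂ), isHW_top hL hH
      (fun n hn => ?_) (fun n hn => hG n (by omega)) (by rw [hH0, topH, add_sub_cancel_right])⟩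
    rcases eq_or_ne n ((k : ℤ) + 1) with rfl | hne
    · rw [h2, flowFactor_eq ht, ← hr, sub_self, mul_zero, zero_smul]
    · exact hQ n (by omega)

end Top

/-! ### Embedded topological Verma modules -/

section Verma

variable {h ℓ t : ℂ}

lemma isFree_massiveVec [LinearOrder Gen] :
    (massiveChar (centralCharge t) 0 ℓ h).IsFree (massiveVec h ℓ t) :=
  Character.isFree_mk _ (massiveIdeal_eq h ℓ t _)

lemma isFree_topVec [LinearOrder Gen] {θ : ℤ} :
    (hwChar _ _ _ _ _ (weightOK_top h t θ)).IsFree (topVec h t θ) :=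
  Character.isFree_mk _ (topIdeal_eq h t θ)

/-- The charged singular vector is a twisted topological highest-weight vector. -/
lemma isHW_chargedVec (ht : t ≠ 0) {r : ℤ} (hr : ℓ = lch r h t) :
    ∃ h', (hwChar _ _ _ _ _ (weightOK_top h' t (-r))).IsHW (chargedVec r h ℓ t) := by
  let _ := rankOrder fun _ => 0
  rw [chargedVec_eq]
  exact isHW_chargedWord ht hr isFree_massiveVec.hw

/-- In the adapted order the charged word is standard and nonempty, so it gives a basis vector other
than the highest-weight vector. -/
lemma chargedVec_ne_smul (r : ℤ) (a : ℂ) : chargedVec r h ℓ t ≠ a • massiveVec h ℓ t := by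
  let _ := rankOrder (compareRank (creation 0 (-1)) (creation (r - 1) (-r - 1)))
  intro he
  have hemb := embeds_hwChar (weightOK_massive (centralCharge t) 0 ℓ h)
    (q' := r - 1) (p' := -r - 1) (a' := topL h t (-r)) (b' := topH h t (-r)) (by
      simpa using weightOK_top h t (-r)) (fun k => of_mem_chargedWord) (pairwise_chargedWord r)
    (fun j => partner_mem_chargedWord)
  have hfree := isFree_massiveVec (h := h) (ℓ := ℓ) (t := t)
  have h1 := hfree.inj (single (chargedWord r) 1 - a • single [] 1)
    (Submodule.sub_mem _ (Character.single_mem_stdSub _ hemb.std)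
      (Submodule.smul_mem _ _ (Character.single_mem_stdSub _ (Character.std_nil _)))) (by
    rw [map_sub, map_smul, Character.toMod_single, Character.toMod_single, ← chargedVec_eq, he]
    simp [word])
  have h2 := DFunLike.congr_fun h1 (chargedWord r)
  simp [(chargedWord_ne_nil r).symm] at h2

/-- The charged singular vector generates a twisted topological Verma module. -/
lemma exists_topVerma_equiv {r : ℤ} {h' : ℂ}
    (hE : (hwChar _ _ _ _ _ (weightOK_top h' t (-r))).IsHW (chargedVec r h ℓ t)) :
    ∃ φ : TopVerma h' t (-r) ≃ₗ[Alg (centralCharge t)]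
        Submodule.span (Alg (centralCharge t)) {chargedVec r h ℓ t},
      (φ (topVec h' t (-r)) : MassiveVerma h ℓ t) = chargedVec r h ℓ t := by
  let _ := rankOrder (compareRank (creation 0 (-0 - 1)) (creation (- -r - 1) (-r - 1)))
  obtain ⟨f, hf⟩ := hE.exists_hom (topIdeal_eq h' t (-r))
  change f (topVec h' t (-r)) = _ at hf
  have hemb := embeds_hwChar (weightOK_massive (centralCharge t) 0 ℓ h)
    (weightOK_top h' t (-r)) (U := chargedWord r)
    (fun k hk => by rw [neg_neg]; exact of_mem_chargedWord hk) (pairwise_chargedWord r)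
    (fun j => by rw [neg_neg]; exact partner_mem_chargedWord)
  -- An element of the kernel is a combination of standard words on `topVec` that vanishes on the
  -- charged vector, so it is zero by independence there.
  have hinj : Function.Injective f := by
    rw [injective_iff_map_eq_zero]
    intro u hu
    obtain ⟨y, hy, rfl⟩ := (isFree_topVec (h := h') (t := t) (θ := -r)).surj u
    have h1 : f (Character.toMod (centralCharge t) (topVec h' t (-r)) y) =
        Character.toMod (centralCharge t) (chargedVec r h ℓ t) y := by
      simp only [Character.toMod, Finsupp.linearCombination_apply, Finsupp.sum, map_sum]
      refine Finset.sum_congr rfl fun W _ => ?_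
      rw [LinearMap.map_smul_of_tower, map_smul, hf]
    rw [h1, chargedVec_eq] at hu
    rw [hemb.eq_zero isFree_massiveVec hy hu, map_zero]
  have hrange : LinearMap.range f = Submodule.span _ {chargedVec r h ℓ t} := by
    refine le_antisymm ?_ (Submodule.span_le.2 ?_)
    · rintro _ ⟨u, rfl⟩
      obtain ⟨a, rfl⟩ := Character.smul_mk_one u
      change f (a • topVec h' t (-r)) ∈ _
      rw [map_smul, hf]
      exact Submodule.smul_mem _ _ (Submodule.mem_span_singleton_self _)
    · rw [Set.singleton_subset_iff]
      exact ⟨_, hf⟩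
  exact ⟨(LinearEquiv.ofInjective f hinj).trans (LinearEquiv.ofEq _ _ hrange), hf⟩

/-- Without a broken link, the image of the topological highest-weight vector would be zero by
`eq_zero_of_annihilated`, although that vector is nonzero by Poincaré–Birkhoff–Witt. -/
lemma exists_eq_lch (ht : t ≠ 0) (hc : ContainsTopVerma t (MassiveVerma h ℓ t)) :
    ∃ r : ℤ, ℓ = lch r h t := by
  by_contra! hno
  let _ := rankOrder fun _ => 0
  obtain ⟨N, h', θ, ⟨φ⟩⟩ := hc
  have htop := isFree_topVec (h := h') (t := t) (θ := θ)
  obtain ⟨-, -, hQ, hG, -, -⟩ := isHW_hwChar_iff.1 htop.hw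
  let ψ := Submodule.quotEquivOfEq _ _
    (massiveIdeal_eq h ℓ t (weightOK_massive (centralCharge t) 0 ℓ h))
  let f : TopVerma h' t θ →ₗ[Alg (centralCharge t)]
      (massiveChar (centralCharge t) 0 ℓ h).Ind :=
    ψ.toLinearMap ∘ₗ N.subtype ∘ₗ φ.symm.toLinearMap
  have hfinj : Function.Injective f :=
    ψ.injective.comp (N.injective_subtype.comp φ.symm.injective)
  have h0 : f (topVec h' t θ) = 0 := by
    refine eq_zero_of_annihilated ht hno θ (fun n hn => ?_) fun n hn => ?_
    · rw [← map_smul, hQ n (by omega), map_zero]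
    · rw [← map_smul, hG n (by omega), map_zero]
  have h1 : topVec h' t θ = 0 := hfinj (h0.trans (map_zero f).symm)
  have h2 := htop.inj (single [] 1)
    (Character.single_mem_stdSub _ (Character.std_nil _)) (by
      rw [Character.toMod_single, h1, smul_zero])
  simp at h2

end Verma

end N2

theorem mainTheorem1 (h ℓ t : ℂ) (ht : t ≠ 0) :
    (N2.ContainsTopVerma t (N2.MassiveVerma h ℓ t) ↔ ∃ r : ℤ, ℓ = N2.lch r h t) ∧
    ∀ r : ℤ, ℓ = N2.lch r h t →
      -- the vector is not proportional to the highest-weight vector; in particular it is nonzero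
      (∀ a : ℂ, N2.chargedVec r h ℓ t ≠ a • N2.massiveVec h ℓ t) ∧
      ∃ h' : ℂ,
        N2.IsTwistedTopHW h' t (-r) (N2.chargedVec r h ℓ t) ∧
        -- it generates a twisted topological Verma submodule, as its highest-weight vector
        ∃ φ : N2.TopVerma h' t (-r) ≃ₗ[N2.Alg (N2.centralCharge t)]
            Submodule.span (N2.Alg (N2.centralCharge t)) {N2.chargedVec r h ℓ t},
          (φ (N2.topVec h' t (-r)) : N2.MassiveVerma h ℓ t) = N2.chargedVec r h ℓ t := by
  refine ⟨⟨N2.exists_eq_lch ht, ?_⟩, fun r hr => ⟨N2.chargedVec_ne_smul r, ?_⟩⟩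
  · rintro ⟨r, hr⟩
    obtain ⟨h', hE⟩ := N2.isHW_chargedVec ht hr
    obtain ⟨φ, -⟩ := N2.exists_topVerma_equiv hE
    exact ⟨_, h', -r, ⟨φ.symm⟩⟩
  · obtain ⟨h', hE⟩ := N2.isHW_chargedVec ht hr
    exact ⟨h', N2.isTwistedTopHW_of_isHW hE, N2.exists_topVerma_equiv hE⟩
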